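/- Let $k$ be a field and $Q$ a locally finite quiver (every vertex is the source of finitely many arrows and the target of finitely many arrows; the vertex set may be infinite). Paths are composed from right to left, $kQ_n(x,y)$ is the span of the paths of length $n$ from $x$ to $y$ in the path algebra $kQ$, and $\varepsilon_x$ is the trivial path at $x$. Let $R$ be a quadratic ideal of $kQ$, i.e. a two-sided ideal generated by a set of elements each lying in some $kQ_2(x,y)$. Put $\Lambda=kQ/R$, write $\bar\gamma$ for the class of $\gamma\in kQ$ and $e_x=\bar\varepsilon_x$, let $J$ be the ideal of $\Lambda$ generated by the classes of arrows, and put $P_x=\Lambda e_x$ and $S_x=\Lambda e_x/Je_x$. Let $\Lambda_n$ be the image of the span of all paths of length $n$; the module $P_x$ is graded by $(P_x)_n=\Lambda_n e_x$, and ${\rm proj}\,\Lambda$ consists of the (modules isomorphic to) finite direct sums of modules $P_x$, graded as direct sums of the graded modules $P_x$. A linear projective resolution of a module $M$ over ${\rm proj}\,\Lambda$ is an exact sequence $$\cdots\to P^{-n}\xrightarrow{d^{-n}}P^{-n+1}\to\cdots\to P^{-1}\xrightarrow{d^{-1}}P^0\xrightarrow{d^0}M\to0$$ with $P^{-n}\in{\rm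 proj}\,\Lambda$ and $\ker d^{-n}\subseteq JP^{-n}$ for all $n\ge0$, in which $d^{-n}$ is homogeneous of degree one for every $n>0$. For vertices $a,x$ put $R_n(a,x)=R\cap kQ_n(a,x)$ and $R^{(n)}(a,x)=kQ_n(a,x)$ for $n=0,1$. For $n\ge2$ let $R^{(n)}(a,x)$ be the subspace of those $\gamma\in R_n(a,x)$ which, for every $0\le j\le n-2$, can be written as a finite sum $\gamma=\sum_i\zeta_i\rho_i\delta_i$ with $\zeta_i\in kQ_{n-2-j}(c_i,x)$, $\rho_i\in R_2(b_i,c_i)$, $\delta_i\in kQ_j(a,b_i)$ for some vertices $b_i,c_i$. For an arrow $\alpha$ let $\partial_\alpha:kQ\to kQ$ be the $k$-linear map sending a path $\alpha\delta$ to $\delta$, and every path whose terminal arrow is not $\alpha$ (in particular every trivial path) to $0$. The local Koszul complex $K_a^\bullet$ has terms $K_a^{-n}=\bigoplus_xP_x\otimes_kR^{(n)}(a,x)$ for $n\ge0$, and zero terms in positive degrees. Its differential $\partial_a^{-n}:K_a^{-n}\to K_a^{-n+1}$, for $n>0$, has components $$\sum_{\alpha:y\to x}P[\bar\alpha]\otimes\partial_\alpha:\;P_x\otimes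 R^{(n)}(a,x)\to P_y\otimes R^{(n-1)}(a,y),\qquad P[\bar\alpha](u)=u\bar\alpha .$$ It is augmented by $\partial_a^0:K_a^0=P_a\otimes k\varepsilon_a\to S_a$, $e_a\otimes\varepsilon_a\mapsto e_a+Je_a$. Theorem. For every vertex $a$ of $Q$, the module $S_a$ has a linear projective resolution over ${\rm proj}\,\Lambda$ if and only if $K_a^\bullet$, with the augmentation $\partial_a^0$, is a projective resolution of $S_a$. Moreover, $K_a^\bullet$ is a projective resolution of $S_a$ if and only if it is exact at all negative degrees, i.e. $\operatorname{im}\partial_a^{-n-1}=\ker\partial_a^{-n}$ for all $n\ge1$. -/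

import Mathlib

open scoped TensorProduct DirectSum

noncomputable section

universe u v w

/-! ## Path algebras of (possibly infinite) quivers -/

/-- A quiver is locally finite if every vertex is the source of only finitely many arrows and the
target of only finitely many arrows. -/
class Quiver.IsLocallyFinite (Q : Type u) [Quiver.{v} Q] : Prop where
  finite_star : ∀ x : Q, Finite (Quiver.Star x)
  finite_costar : ∀ x : Q, Finite (Quiver.Costar x)

/-- The set of all paths of a quiver `Q`, of the form `⟨x, y, p⟩` with `p` a path from `x`
to `y`. -/
abbrev QPath (Q : Type u) [Quiver.{v} Q] : Type (max u v) := Σ x y : Q, Quiver.Path x y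

/-- The path algebra `kQ` as a vector space: it has the set of all paths as a basis. -/
structure PathAlgebra (k : Type w) (Q : Type u) [Field k] [Quiver.{v} Q] : Type (max u v w) where
  /-- The coordinates with respect to the basis of paths. -/
  coeff : QPath Q →₀ k

namespace PathAlgebra

variable {k : Type w} {Q : Type u} [Field k] [Quiver.{v} Q]

/-- The identification with finitely supported functions on the set of paths. -/
def coeffEquiv : PathAlgebra k Q ≃ (QPath Q →₀ k) := ⟨coeff, mk, fun _ => rfl, fun _ => rfl⟩

instance : AddCommGroup (PathAlgebra k Q) := (coeffEquiv (k := k) (Q := Q)).addCommGroup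

instance : Module k (PathAlgebra k Q) := (coeffEquiv (k := k) (Q := Q)).module k

/-- The linear identification with finitely supported functions on the set of paths. -/
def coeffLinear : PathAlgebra k Q ≃ₗ[k] (QPath Q →₀ k) :=
  { coeffEquiv with
    map_add' := fun _ _ => rfl
    map_smul' := fun _ _ => rfl }

/-- The basis of the path algebra given by all paths. -/
def pathBasis : Module.Basis (QPath Q) k (PathAlgebra k Q) := ⟨coeffLinear⟩

/-- A path `p` as an element of the path algebra. -/
def ofPath {x y : Q} (p : Quiver.Path x y) : PathAlgebra k Q := pathBasis ⟨x, y, p⟩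

open Classical in
/-- The product `p q` of two paths: first `q`, then `p`; it is zero if `q` does not end where `p`
starts. -/
def pathMul (p q : QPath Q) : PathAlgebra k Q :=
  if h : q.2.1 = p.1 then ofPath (q.2.2.comp (p.2.2.cast h.symm rfl)) else 0

/-- The bilinear extension of the product of paths. -/
def mulLinear : PathAlgebra k Q →ₗ[k] PathAlgebra k Q →ₗ[k] PathAlgebra k Q :=
  pathBasis.constr k fun p => pathBasis.constr k fun q => pathMul p q

instance : Mul (PathAlgebra k Q) := ⟨fun f g => mulLinear f g⟩

theorem mul_def (f g : PathAlgebra k Q) : f * g = mulLinear f g := rfl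

theorem ofPath_mul_ofPath {x y z : Q} (p : Quiver.Path y z) (q : Quiver.Path x y) :
    (ofPath p * ofPath q : PathAlgebra k Q) = ofPath (q.comp p) := by
  simp [mul_def, mulLinear, ofPath, Module.Basis.constr_basis, pathMul]

theorem ofPath_mul_ofPath_of_ne {x y y' z : Q} (p : Quiver.Path y' z) (q : Quiver.Path x y)
    (h : y ≠ y') : (ofPath p * ofPath q : PathAlgebra k Q) = 0 := by
  simp [mul_def, mulLinear, ofPath, Module.Basis.constr_basis, pathMul, h]

@[elab_as_elim]
theorem induction_path {P : PathAlgebra k Q → Prop} (f : PathAlgebra k Q)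
    (h0 : P 0) (hadd : ∀ f g, P f → P g → P (f + g))
    (hpath : ∀ (c : k) (x y : Q) (p : Quiver.Path x y), P (c • ofPath p)) : P f := by
  have hf : f ∈ Submodule.span k (Set.range (pathBasis (k := k) (Q := Q))) := by
    rw [pathBasis.span_eq]; trivial
  refine Submodule.span_induction (p := fun f _ => ∀ c : k, P (c • f)) ?_ ?_ ?_ ?_ hf 1 |>
    fun h => by simpa using h
  · rintro _ ⟨⟨x, y, p⟩, rfl⟩ c
    exact hpath c x y p
  · intro c; simpa using h0
  · intro f g _ _ hf hg c; rw [smul_add]; exact hadd _ _ (hf c) (hg c)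
  · intro c f _ hf d; rw [smul_smul]; exact hf _

instance : NonUnitalNonAssocRing (PathAlgebra k Q) where
  left_distrib f g h := by simp [mul_def]
  right_distrib f g h := by simp [mul_def]
  zero_mul f := by simp [mul_def]
  mul_zero f := by simp [mul_def]

instance : IsScalarTower k (PathAlgebra k Q) (PathAlgebra k Q) :=
  ⟨fun c f g => by simp [mul_def]⟩

instance : SMulCommClass k (PathAlgebra k Q) (PathAlgebra k Q) :=
  ⟨fun c f g => by simp [mul_def]⟩

instance : NonUnitalRing (PathAlgebra k Q) where
  mul_assoc f g h := by
    induction f using induction_path with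
    | h0 => simp
    | hadd f f' hf hf' => simp only [add_mul, hf, hf']
    | hpath c x y p =>
    induction g using induction_path with
    | h0 => simp
    | hadd g g' hg hg' => simp only [add_mul, mul_add, hg, hg']
    | hpath d x' y' q =>
    induction h using induction_path with
    | h0 => simp
    | hadd h h' hh hh' => simp only [mul_add, hh, hh']
    | hpath e x'' y'' r =>
    simp only [smul_mul_assoc, mul_smul_comm]
    congr 3
    by_cases h1 : y' = x
    · subst h1
      by_cases h2 : y'' = x'
      · subst h2
        simp [ofPath_mul_ofPath]
      · simp [ofPath_mul_ofPath, ofPath_mul_ofPath_of_ne _ _ h2]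
    · by_cases h2 : y'' = x'
      · subst h2
        simp [ofPath_mul_ofPath, ofPath_mul_ofPath_of_ne _ _ h1]
      · simp [ofPath_mul_ofPath_of_ne _ _ h1, ofPath_mul_ofPath_of_ne _ _ h2]

/-- The subspace `kQ_n(x, y)` spanned by the paths of length `n` from `x` to `y`. -/
def homPart (k : Type w) {Q : Type u} [Field k] [Quiver.{v} Q] (n : ℕ) (x y : Q) :
    Submodule k (PathAlgebra k Q) :=
  Submodule.span k {f | ∃ p : Quiver.Path x y, p.length = n ∧ f = ofPath p}

/-- The subspace `kQ_n` spanned by all paths of length `n`. -/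
def degreePart (k : Type w) (Q : Type u) [Field k] [Quiver.{v} Q] (n : ℕ) :
    Submodule k (PathAlgebra k Q) :=
  Submodule.span k {f | ∃ (x y : Q) (p : Quiver.Path x y), p.length = n ∧ f = ofPath p}

/-- An ideal of `kQ` is quadratic if it is generated by a set of quadratic relations, i.e. of
elements each of which lies in `kQ_2(x, y)` for some vertices `x, y`. -/
def IsQuadratic (R : TwoSidedIdeal (PathAlgebra k Q)) : Prop :=
  ∃ S : Set (PathAlgebra k Q), (∀ ρ ∈ S, ∃ x y : Q, ρ ∈ homPart k 2 x y) ∧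
    R = TwoSidedIdeal.span S

open Classical in
/-- The map `∂_α : kQ → kQ` on paths: `∂_α (α δ) = δ`, and `∂_α ρ = 0` if `α` is not the terminal
arrow of `ρ`. -/
def stripPath {y x : Q} (α : y ⟶ x) : QPath Q → PathAlgebra k Q
  | ⟨_, _, Quiver.Path.nil⟩ => 0
  | ⟨_, _, Quiver.Path.cons (b := b) (c := c) δ β⟩ =>
      if (⟨b, c, β⟩ : Σ s t : Q, s ⟶ t) = ⟨y, x, α⟩ then ofPath δ else 0

/-- The `k`-linear map `∂_α : kQ → kQ` deleting the terminal arrow `α`. -/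
def strip {y x : Q} (α : y ⟶ x) : PathAlgebra k Q →ₗ[k] PathAlgebra k Q :=
  pathBasis.constr k (stripPath α)

theorem strip_ofPath_nil {y x z : Q} (α : y ⟶ x) :
    strip α (ofPath (Quiver.Path.nil : Quiver.Path z z) : PathAlgebra k Q) = 0 := by
  simp [strip, ofPath, Module.Basis.constr_basis, stripPath]

theorem strip_ofPath_cons {y x z : Q} (α : y ⟶ x) (δ : Quiver.Path z y) :
    strip α (ofPath (δ.cons α) : PathAlgebra k Q) = ofPath δ := by
  simp [strip, ofPath, Module.Basis.constr_basis, stripPath]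

theorem strip_ofPath_cons_of_ne {y x z b c : Q} (α : y ⟶ x) (δ : Quiver.Path z b) (β : b ⟶ c)
    (h : (⟨b, c, β⟩ : Σ s t : Q, s ⟶ t) ≠ ⟨y, x, α⟩) :
    strip α (ofPath (δ.cons β) : PathAlgebra k Q) = 0 := by
  simp [strip, ofPath, Module.Basis.constr_basis, stripPath, h]

theorem strip_mem_homPart {y x a c : Q} (α : y ⟶ x) {n : ℕ} {f : PathAlgebra k Q}
    (hf : f ∈ homPart k (n + 1) a c) : strip α f ∈ homPart k n a y := by
  induction hf using Submodule.span_induction with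
  | zero => simp
  | add f g _ _ hf hg => rw [map_add]; exact add_mem hf hg
  | smul c f _ hf => rw [map_smul]; exact Submodule.smul_mem _ _ hf
  | mem f hf =>
    obtain ⟨p, hp, rfl⟩ := hf
    cases p with
    | nil => simp at hp
    | @cons b _ δ β =>
      by_cases h : (⟨b, c, β⟩ : Σ s t : Q, s ⟶ t) = ⟨y, x, α⟩
      · cases h
        rw [strip_ofPath_cons]
        exact Submodule.subset_span ⟨δ, by simpa using hp, rfl⟩
      · rw [strip_ofPath_cons_of_ne α δ β h]; exact zero_mem _

/-- `∂_α (ζ g) = ∂_α (ζ) g` when `ζ` has positive degree. -/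
theorem strip_mul {y x b c : Q} (α : y ⟶ x) {n : ℕ} {ζ : PathAlgebra k Q}
    (hζ : ζ ∈ homPart k (n + 1) b c) (g : PathAlgebra k Q) :
    strip α (ζ * g) = strip α ζ * g := by
  induction hζ using Submodule.span_induction with
  | zero => simp
  | add f f' _ _ hf hf' => rw [add_mul, map_add, map_add, add_mul, hf, hf']
  | smul c f _ hf => rw [smul_mul_assoc, map_smul, map_smul, smul_mul_assoc, hf]
  | mem f hf =>
    obtain ⟨p, hp, rfl⟩ := hf
    induction g using induction_path with
    | h0 => simp
    | hadd g g' hg hg' => simp only [mul_add, map_add, hg, hg']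
    | hpath d s t q =>
    simp only [mul_smul_comm, map_smul]
    congr 1
    cases p with
    | nil => simp at hp
    | @cons e _ δ β =>
      by_cases h : t = b
      · subst h
        rw [ofPath_mul_ofPath, Quiver.Path.comp_cons]
        by_cases h' : (⟨e, c, β⟩ : Σ s t : Q, s ⟶ t) = ⟨y, x, α⟩
        · cases h'
          rw [strip_ofPath_cons, strip_ofPath_cons, ofPath_mul_ofPath]
        · rw [strip_ofPath_cons_of_ne α _ β h', strip_ofPath_cons_of_ne α _ β h', zero_mul]
      · rw [ofPath_mul_ofPath_of_ne _ _ h, map_zero]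
        by_cases h' : (⟨e, c, β⟩ : Σ s t : Q, s ⟶ t) = ⟨y, x, α⟩
        · cases h'
          rw [strip_ofPath_cons, ofPath_mul_ofPath_of_ne _ _ h]
        · rw [strip_ofPath_cons_of_ne α _ β h', zero_mul]

open Classical in
/-- Every element of `kQ` has a local right identity. -/
theorem exists_local_unit (f : PathAlgebra k Q) : ∃ S : Finset Q, ∀ T : Finset Q, S ⊆ T →
    f * ∑ x ∈ T, ofPath (Quiver.Path.nil : Quiver.Path x x) = f := by
  induction f using induction_path with
  | h0 => exact ⟨∅, fun T _ => by simp⟩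
  | hadd f g hf hg =>
    obtain ⟨S, hS⟩ := hf
    obtain ⟨S', hS'⟩ := hg
    refine ⟨S ∪ S', fun T hT => ?_⟩
    rw [add_mul, hS T (Finset.union_subset_left hT), hS' T (Finset.union_subset_right hT)]
  | hpath c x y p =>
    refine ⟨{x}, fun T hT => ?_⟩
    rw [Finset.mul_sum, Finset.sum_eq_single x]
    · rw [smul_mul_assoc, ofPath_mul_ofPath, Quiver.Path.nil_comp]
    · intro z _ hz
      rw [smul_mul_assoc, ofPath_mul_ofPath_of_ne _ _ hz, smul_zero]
    · intro hx
      exact absurd (hT (Finset.mem_singleton_self x)) hx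

/-- A two-sided ideal of `kQ` is automatically a `k`-subspace. -/
theorem smul_mem_ideal (R : TwoSidedIdeal (PathAlgebra k Q)) (c : k) {f : PathAlgebra k Q}
    (hR : f ∈ R) : c • f ∈ R := by
  obtain ⟨S, hS⟩ := exists_local_unit f
  rw [← hS S subset_rfl, ← mul_smul_comm]
  exact R.mul_mem_right _ _ hR

/-- The subspace `R_n(x, y) = R ∩ kQ_n(x, y)`. -/
def relPart (R : TwoSidedIdeal (PathAlgebra k Q)) (n : ℕ) (x y : Q) :
    Submodule k (PathAlgebra k Q) where
  carrier := {f | f ∈ R ∧ f ∈ homPart k n x y}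
  add_mem' hf hg := ⟨R.add_mem hf.1 hg.1, add_mem hf.2 hg.2⟩
  zero_mem' := ⟨R.zero_mem, zero_mem _⟩
  smul_mem' c _ hf := ⟨smul_mem_ideal R c hf.1, Submodule.smul_mem _ c hf.2⟩

/-- The sums of elements `ζ ρ δ` with `ζ ∈ kQ_i(c, x)`, `ρ ∈ R_2(b, c)`, `δ ∈ kQ_j(a, b)`. -/
def sandwich (R : TwoSidedIdeal (PathAlgebra k Q)) (i j : ℕ) (a x : Q) :
    Submodule k (PathAlgebra k Q) :=
  Submodule.span k {f | ∃ (b c : Q), ∃ ζ ∈ homPart k i c x, ∃ ρ ∈ relPart R 2 b c,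
    ∃ δ ∈ homPart k j a b, f = ζ * ρ * δ}

/-- The subspaces `R^{(n)}(a, x)`: they are `kQ_n(a, x)` for `n = 0, 1`, and for `n + 2` the
subspace of `R_{n+2}(a, x)` of the elements which, for every `0 ≤ j ≤ n`, are sums of
elements `ζ ρ δ` with `ζ ∈ kQ_{n-j}`, `ρ ∈ R_2`, `δ ∈ kQ_j`. -/
def koszulPart (R : TwoSidedIdeal (PathAlgebra k Q)) : ℕ → Q → Q → Submodule k (PathAlgebra k Q)
  | 0, a, x => homPart k 0 a x
  | 1, a, x => homPart k 1 a x
  | n + 2, a, x => relPart R (n + 2) a x ⊓ ⨅ (j : ℕ) (_ : j ≤ n), sandwich R (n - j) j a x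

theorem koszulPart_le (R : TwoSidedIdeal (PathAlgebra k Q)) (n : ℕ) (a x : Q) :
    koszulPart R n a x ≤ homPart k n a x := by
  match n with
  | 0 => exact le_rfl
  | 1 => exact le_rfl
  | n + 2 => exact fun f hf => hf.1.2

theorem strip_mem_sandwich (R : TwoSidedIdeal (PathAlgebra k Q)) {y x a : Q} (α : y ⟶ x)
    {i j : ℕ} {f : PathAlgebra k Q} (hf : f ∈ sandwich R (i + 1) j a x) :
    strip α f ∈ sandwich R i j a y := by
  induction hf using Submodule.span_induction with
  | zero => simp
  | add f g _ _ hf hg => rw [map_add]; exact add_mem hf hg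
  | smul c f _ hf => rw [map_smul]; exact Submodule.smul_mem _ _ hf
  | mem f hf =>
    obtain ⟨b, c, ζ, hζ, ρ, hρ, δ, hδ, rfl⟩ := hf
    rw [mul_assoc, strip_mul α hζ, ← mul_assoc]
    exact Submodule.subset_span ⟨b, c, _, strip_mem_homPart α hζ, ρ, hρ, δ, hδ, rfl⟩

theorem sandwich_mem (R : TwoSidedIdeal (PathAlgebra k Q)) {x a : Q}
    {i j : ℕ} {f : PathAlgebra k Q} (hf : f ∈ sandwich R i j a x) : f ∈ R := by
  induction hf using Submodule.span_induction with
  | zero => exact R.zero_mem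
  | add f g _ _ hf hg => exact R.add_mem hf hg
  | smul c f _ hf => exact smul_mem_ideal R c hf
  | mem f hf =>
    obtain ⟨b, c, ζ, hζ, ρ, hρ, δ, hδ, rfl⟩ := hf
    exact R.mul_mem_right _ _ (R.mul_mem_left _ _ hρ.1)

/-- `∂_α` maps `R^{(n+1)}(a, x)` into `R^{(n)}(a, y)` for every arrow `α : y ⟶ x`. -/
theorem strip_mem_koszulPart (R : TwoSidedIdeal (PathAlgebra k Q)) {y x a : Q} (α : y ⟶ x)
    {n : ℕ} {f : PathAlgebra k Q} (hf : f ∈ koszulPart R (n + 1) a x) :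
    strip α f ∈ koszulPart R n a y := by
  have h0 := strip_mem_homPart α (koszulPart_le R _ _ _ hf)
  match n with
  | 0 => exact h0
  | 1 => exact h0
  | n + 2 =>
    have key : ∀ j ≤ n, strip α f ∈ sandwich R (n - j) j a y := by
      intro j hj
      have h1 := hf.2
      simp only [SetLike.mem_coe, Submodule.mem_iInf] at h1
      have h2 := h1 j (by omega)
      rw [show n + 1 - j = (n - j) + 1 by omega] at h2
      exact strip_mem_sandwich R α h2
    refine ⟨⟨sandwich_mem R (key 0 (Nat.zero_le _)), h0⟩, ?_⟩
    simp only [SetLike.mem_coe, Submodule.mem_iInf]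
    exact key

end PathAlgebra

/-! ## Algebras given by a quiver with relations, and their modules -/

namespace BoundQuiver

variable {k : Type w} {Q : Type u} [Field k] [Quiver.{v} Q]

/-- The algebra `Λ = kQ/R`. It has no identity element if `Q` has infinitely many vertices. -/
def Alg (R : TwoSidedIdeal (PathAlgebra k Q)) : Type (max u v w) := R.ringCon.Quotient

variable (R : TwoSidedIdeal (PathAlgebra k Q))

instance : NonUnitalRing (Alg R) := inferInstanceAs (NonUnitalRing R.ringCon.Quotient)

/-- The class `γ̄ = γ + R` of `γ ∈ kQ`. -/
def toAlg (γ : PathAlgebra k Q) : Alg R := (γ : R.ringCon.Quotient)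

instance : SMul k (Alg R) where
  smul c := Quotient.map' (fun f => c • f) fun f g h => by
    have h' : f - g ∈ R := (TwoSidedIdeal.rel_iff R f g).1 h
    refine (TwoSidedIdeal.rel_iff R (c • f) (c • g)).2 ?_
    rw [← smul_sub]
    exact PathAlgebra.smul_mem_ideal R c h'

theorem toAlg_surjective : Function.Surjective (toAlg R) := Quotient.mk''_surjective

instance : Module k (Alg R) :=
  Function.Surjective.module k
    { toFun := toAlg R, map_zero' := rfl, map_add' := fun _ _ => rfl }
    (toAlg_surjective R) fun _ _ => rfl

instance : IsScalarTower k (Alg R) (Alg R) where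
  smul_assoc c u v := by
    obtain ⟨f, rfl⟩ := toAlg_surjective R u
    obtain ⟨g, rfl⟩ := toAlg_surjective R v
    exact congrArg (toAlg R) (smul_assoc c f g)

instance : SMulCommClass k (Alg R) (Alg R) where
  smul_comm c u v := by
    obtain ⟨f, rfl⟩ := toAlg_surjective R u
    obtain ⟨g, rfl⟩ := toAlg_surjective R v
    exact congrArg (toAlg R) (smul_comm c f g)

/-- The canonical projection `kQ → Λ` as a `k`-linear map. -/
def toAlgLinear : PathAlgebra k Q →ₗ[k] Alg R where
  toFun := toAlg R
  map_add' _ _ := rfl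
  map_smul' _ _ := rfl

/-- The algebra obtained from `Λ` by adjoining an identity element. Left modules over the
(in general non-unital) `k`-algebra `Λ` are the same thing as modules over this unital ring, with
the same submodules, quotients and linear maps. All modules below are unitary over `Λ`, that is,
they satisfy `M = ∑ₓ eₓ M`. -/
abbrev AlgOne : Type (max u v w) := Unitization k (Alg R)

/-- The class of `γ ∈ kQ`, as an element of the algebra with adjoined identity. -/
def bar : PathAlgebra k Q →ₗ[k] AlgOne R := (Unitization.inrHom k k (Alg R)).comp (toAlgLinear R)

theorem bar_mul (f g : PathAlgebra k Q) : bar R (f * g) = bar R f * bar R g :=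
  Unitization.inr_mul k (toAlg R f) (toAlg R g)

/-- The class `ᾱ` of an arrow `α`. -/
def arrow {x y : Q} (α : x ⟶ y) : AlgOne R := bar R (PathAlgebra.ofPath α.toPath)

/-- The idempotent `eₓ` of `Λ`. -/
def idem (x : Q) : AlgOne R := bar R (PathAlgebra.ofPath (Quiver.Path.nil : Quiver.Path x x))

/-- The projective module `Pₓ = Λ eₓ`; this is also the left ideal generated by `eₓ` after
adjoining an identity, since `eₓ = eₓ eₓ`. -/
def proj (x : Q) : Ideal (AlgOne R) := Ideal.span {idem R x}

/-- The ideal `J` of `Λ` generated by the classes of the arrows. -/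
def radIdeal : TwoSidedIdeal (Alg R) :=
  TwoSidedIdeal.span {u | ∃ (x y : Q) (α : x ⟶ y), u = toAlg R (PathAlgebra.ofPath α.toPath)}

/-- The submodule `J M` of a module `M`. -/
def radMul (M : Type*) [AddCommGroup M] [Module (AlgOne R) M] : Submodule (AlgOne R) M :=
  Submodule.span (AlgOne R) {m | ∃ j ∈ radIdeal R, ∃ p : M, m = (j : AlgOne R) • p}

/-- The simple module `S_a = P_a / J P_a = Λ e_a / J e_a`. -/
abbrev simple (a : Q) : Type (max u v w) := proj R a ⧸ radMul R (proj R a)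

/-- The graded piece `Λ_n`: the image of `kQ_n`. -/
def gradedPart (n : ℕ) : Submodule k (AlgOne R) := (PathAlgebra.degreePart k Q n).map (bar R)

/-- A finite direct sum `P_{x 1} ⊕ ⋯ ⊕ P_{x m}`. Up to isomorphism these are the objects of the
additive category `proj Λ`. -/
abbrev projSum {m : ℕ} (x : Fin m → Q) : Type (max u v w) := ∀ i, proj R (x i)

/-- The elements of degree `n` of `P_{x 1} ⊕ ⋯ ⊕ P_{x m}`, where each `Pₓ = Λ eₓ` is graded by
`(Pₓ)_n = Λ_n eₓ = Pₓ ∩ Λ_n` (so that it is generated in degree `0`). -/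
def projSumDegree {m : ℕ} (x : Fin m → Q) (n : ℕ) : Set (projSum R x) :=
  {v | ∀ i, (v i : AlgOne R) ∈ gradedPart R n}

/-- A linear projective resolution over `proj Λ` of a module `M`: an exact sequence
`⋯ → P⁻² → P⁻¹ → P⁰ → M → 0` with every `P⁻ⁿ` in `proj Λ`, in which every map co-restricts to a
projective `J`-cover of its image (i.e. has kernel contained in `J P⁻ⁿ`), and in which all the
maps between the projective modules are homogeneous of degree one. -/
structure LinearProjectiveResolution (M : Type*) [AddCommGroup M] [Module (AlgOne R) M] where
  /-- The number of summands of `P⁻ⁿ`. -/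
  rank : ℕ → ℕ
  /-- The vertices `x` of the summands `Pₓ` of `P⁻ⁿ`. -/
  vertex : ∀ n, Fin (rank n) → Q
  /-- The differential `P⁻⁽ⁿ⁺¹⁾ → P⁻ⁿ`. -/
  d : ∀ n, projSum R (vertex (n + 1)) →ₗ[AlgOne R] projSum R (vertex n)
  /-- The augmentation `P⁰ → M`. -/
  aug : projSum R (vertex 0) →ₗ[AlgOne R] M
  aug_surjective : Function.Surjective aug
  exact_zero : Function.Exact (d 0) aug
  exact_succ : ∀ n, Function.Exact (d (n + 1)) (d n)
  minimal_zero : LinearMap.ker aug ≤ radMul R (projSum R (vertex 0))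
  minimal_succ : ∀ n, LinearMap.ker (d n) ≤ radMul R (projSum R (vertex (n + 1)))
  linear : ∀ n i, ∀ v ∈ projSumDegree R (vertex (n + 1)) i,
    d n v ∈ projSumDegree R (vertex n) (i + 1)

/-- A sequence `⋯ → K⁻² → K⁻¹ → K⁰` of modules, with an augmentation `K⁰ → M`, is a projective
resolution of `M`. -/
structure IsProjectiveResolution (M : Type*) [AddCommGroup M] [Module (AlgOne R) M]
    (K : ℕ → Type*) [∀ n, AddCommMonoid (K n)] [∀ n, Module (AlgOne R) (K n)]
    (d : ∀ n, K (n + 1) →ₗ[AlgOne R] K n) (aug : K 0 →ₗ[AlgOne R] M) : Prop where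
  projective : ∀ n, Module.Projective (AlgOne R) (K n)
  aug_surjective : Function.Surjective aug
  exact_zero : Function.Exact (d 0) aug
  exact_succ : ∀ n, Function.Exact (d (n + 1)) (d n)

theorem mul_mem_proj {a x : Q} {n : ℕ} {γ : PathAlgebra k Q}
    (hγ : γ ∈ PathAlgebra.homPart k n a x) (u : AlgOne R) : u * bar R γ ∈ proj R a := by
  have h : γ = γ * PathAlgebra.ofPath (Quiver.Path.nil : Quiver.Path a a) := by
    induction hγ using Submodule.span_induction with
    | zero => simp
    | add f f' _ _ hf hf' => rw [add_mul, ← hf, ← hf']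
    | smul c f _ hf => rw [smul_mul_assoc, ← hf]
    | mem f hf =>
      obtain ⟨p, -, rfl⟩ := hf
      rw [PathAlgebra.ofPath_mul_ofPath, Quiver.Path.nil_comp]
  rw [h, bar_mul, ← mul_assoc]
  exact Ideal.mul_mem_left _ _ (Ideal.subset_span rfl)

theorem arrow_mem_homPart {y x : Q} (α : y ⟶ x) :
    (PathAlgebra.ofPath α.toPath : PathAlgebra k Q) ∈ PathAlgebra.homPart k 1 y x :=
  Submodule.subset_span ⟨_, rfl, rfl⟩

/-- The `Λ`-linear map `P[ᾱ] : Pₓ → P_y`, `u ↦ u ᾱ`, for an arrow `α : y ⟶ x`. -/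
def projMap {y x : Q} (α : y ⟶ x) : proj R x →ₗ[AlgOne R] proj R y where
  toFun u := ⟨u * arrow R α, mul_mem_proj R (arrow_mem_homPart α) u⟩
  map_add' _ _ := Subtype.ext (add_mul _ _ _)
  map_smul' _ _ := Subtype.ext (mul_assoc _ _ _)

/-! ## The local Koszul complex -/

/-- The restriction `∂_α : R^{(n+1)}(a, x) → R^{(n)}(a, y)` for an arrow `α : y ⟶ x`. -/
def stripKoszul (a : Q) (n : ℕ) {y x : Q} (α : y ⟶ x) :
    PathAlgebra.koszulPart R (n + 1) a x →ₗ[k] PathAlgebra.koszulPart R n a y :=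
  (PathAlgebra.strip α).restrict fun _ hf => PathAlgebra.strip_mem_koszulPart R α hf

/-- The module `K_a⁻ⁿ = ⨁ₓ Pₓ ⊗ R^{(n)}(a, x)`. -/
abbrev koszulTerm (a : Q) (n : ℕ) : Type (max u v w) :=
  ⨁ x : Q, (proj R x ⊗[k] PathAlgebra.koszulPart R n a x)

open Classical in
/-- The differential `K_a⁻⁽ⁿ⁺¹⁾ → K_a⁻ⁿ`, with components
`∑_α P[ᾱ] ⊗ ∂_α : Pₓ ⊗ R^{(n+1)}(a, x) → P_y ⊗ R^{(n)}(a, y)`, where `α` runs over the arrows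
`y ⟶ x`; for fixed `x` there are only finitely many of these in total. -/
def koszulD [Quiver.IsLocallyFinite Q] (a : Q) (n : ℕ) :
    koszulTerm R a (n + 1) →ₗ[AlgOne R] koszulTerm R a n :=
  DirectSum.toModule (AlgOne R) Q _ fun x =>
    letI := Quiver.IsLocallyFinite.finite_costar x
    letI := Fintype.ofFinite (Quiver.Costar x)
    ∑ α : Quiver.Costar x,
      (DirectSum.lof (AlgOne R) Q (fun y => proj R y ⊗[k] PathAlgebra.koszulPart R n a y) α.1).comp
        (TensorProduct.AlgebraTensorModule.map (projMap R α.2) (stripKoszul R a n α.2))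

/-- The `Λ`-linear map `Pₓ ⊗ R^{(0)}(a, x) → P_a`, `u ⊗ γ ↦ u γ̄`. -/
def koszulAugAux (a x : Q) :
    proj R x ⊗[k] PathAlgebra.koszulPart R 0 a x →ₗ[AlgOne R] proj R a :=
  TensorProduct.AlgebraTensorModule.lift
    { toFun := fun u =>
        { toFun := fun γ => ⟨u * bar R γ, mul_mem_proj R γ.2 u⟩
          map_add' := fun γ γ' => Subtype.ext (by simp [mul_add])
          map_smul' := fun c γ => Subtype.ext (by simp) }
      map_add' := fun _ _ => LinearMap.ext fun _ => Subtype.ext (add_mul _ _ _)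
      map_smul' := fun _ _ => LinearMap.ext fun _ => Subtype.ext (mul_assoc _ _ _) }

open Classical in
/-- The `Λ`-linear map `K_a⁰ = P_a ⊗ k ε_a → S_a`, `e_a ⊗ ε_a ↦ e_a + J P_a`. -/
def koszulAug (a : Q) : koszulTerm R a 0 →ₗ[AlgOne R] simple R a :=
  (Submodule.mkQ (radMul R (proj R a))).comp
    (DirectSum.toModule (AlgOne R) Q _ fun x => koszulAugAux R a x)

end BoundQuiver

end

/-! Only degrees 0 and 1 of Λ matter. Since R lies in the span of the paths of length at least two,
Λ_n meets the image of the longer paths only in 0 when n ≤ 1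
(`eq_zero_of_mem_gradedPart_of_mem_gePart`). In particular the classes of the arrows stay linearly
independent.

Let M satisfy JM = 0. A complex of finite sums of modules Pₓ augmented to M is diagonal
(`IsDiagonal`) if the augmentation is onto and injective in degree zero, and every differential maps
the degree zero part of its source bijectively onto the degree one part of the kernel of the next
map. A sum of modules Pₓ is generated in degree zero, so each stage of a diagonal complex is
determined up to isomorphism by the stages before it. A linear projective resolution is diagonal:
minimality gives injectivity, and exactness with linearity gives the image
(`LinearProjectiveResolution.isDiagonal`). Hence, if M has one, every diagonal complex over M is
isomorphic to it stage by stage and is exact (`IsDiagonal.exact_of_resolution`). Conversely, an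
exact diagonal complex is a linear projective resolution (`IsDiagonal.toResolution`); exactness at
P⁰ is automatic (`IsDiagonal.exact_zero`).

It remains to see that the Koszul complex is always diagonal (`isDiagonal_koszul`). A degree one
element of K_a⁻ⁿ is a sum of terms β̄ ⊗ g_β with g_β in R^{(n)}, and its natural preimage is the sum
over z of e_z ⊗ ∑ β g_β, with β running over the arrows into z. The question is whether ∑ β g_β lies
in R^{(n+1)}. The conditions with j < n - 1 are inherited from the g_β. The last one, j = n - 1,
says that the part preceding each path δ of length n - 1 is a relation, and this follows from the
vanishing of the differential (`sum_arrow_mul_mem_koszulPart`). -/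

noncomputable section

universe u v w

/-! ## Path length and coefficients in the path algebra -/

namespace PathAlgebra

variable {k : Type w} {Q : Type u} [Field k] [Quiver.{v} Q]

/-- The coefficient of a path in an element of the path algebra. -/
def pathCoeff (p : QPath Q) : PathAlgebra k Q →ₗ[k] k := pathBasis.coord p

theorem pathCoeff_ofPath_self {x y : Q} (p : Quiver.Path x y) :
    pathCoeff ⟨x, y, p⟩ (ofPath p : PathAlgebra k Q) = 1 := by
  simp [pathCoeff, ofPath]

theorem pathCoeff_ofPath_of_ne {x y : Q} (p : Quiver.Path x y) (q : QPath Q)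
    (h : q ≠ ⟨x, y, p⟩) : pathCoeff q (ofPath p : PathAlgebra k Q) = 0 := by
  simp only [pathCoeff, ofPath, Module.Basis.coord_apply, Module.Basis.repr_self]
  exact Finsupp.single_eq_of_ne h

theorem ext_pathCoeff {f g : PathAlgebra k Q} (h : ∀ p, pathCoeff p f = pathCoeff p g) :
    f = g :=
  pathBasis.ext_elem h

theorem pathCoeff_of_mem_homPart {n : ℕ} {x y : Q} {f : PathAlgebra k Q} (hf : f ∈ homPart k n x y)
    (p : QPath Q) (hp : ¬ (p.1 = x ∧ p.2.1 = y ∧ p.2.2.length = n)) : pathCoeff p f = 0 := by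
  have : homPart k n x y ≤ LinearMap.ker (pathCoeff p) := by
    refine Submodule.span_le.2 ?_
    rintro _ ⟨q, hq, rfl⟩
    refine pathCoeff_ofPath_of_ne q p ?_
    rintro rfl
    exact hp ⟨rfl, rfl, hq⟩
  exact this hf

/-! ### The length filtration and grading of kQ -/

/-- The span of the paths of length at least `n`. -/
def geDegree (k : Type w) (Q : Type u) [Field k] [Quiver.{v} Q] (n : ℕ) :
    Submodule k (PathAlgebra k Q) :=
  Submodule.span k {f | ∃ (x y : Q) (p : Quiver.Path x y), n ≤ p.length ∧ f = ofPath p}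

theorem ofPath_mem_geDegree {x y : Q} (p : Quiver.Path x y) {n : ℕ} (h : n ≤ p.length) :
    (ofPath p : PathAlgebra k Q) ∈ geDegree k Q n :=
  Submodule.subset_span ⟨x, y, p, h, rfl⟩

theorem ofPath_mem_degreePart {x y : Q} (p : Quiver.Path x y) :
    (ofPath p : PathAlgebra k Q) ∈ degreePart k Q p.length :=
  Submodule.subset_span ⟨x, y, p, rfl, rfl⟩

theorem ofPath_mem_homPart {x y : Q} (p : Quiver.Path x y) :
    (ofPath p : PathAlgebra k Q) ∈ homPart k p.length x y :=
  Submodule.subset_span ⟨p, rfl, rfl⟩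

theorem homPart_le_degreePart (n : ℕ) (x y : Q) : homPart k n x y ≤ degreePart k Q n := by
  refine Submodule.span_mono ?_
  rintro _ ⟨p, hp, rfl⟩
  exact ⟨x, y, p, hp, rfl⟩

theorem degreePart_le_geDegree (n : ℕ) : degreePart k Q n ≤ geDegree k Q n := by
  refine Submodule.span_mono ?_
  rintro _ ⟨x, y, p, hp, rfl⟩
  exact ⟨x, y, p, hp.ge, rfl⟩

theorem geDegree_anti {m n : ℕ} (h : m ≤ n) : geDegree k Q n ≤ geDegree k Q m := by
  refine Submodule.span_mono ?_
  rintro _ ⟨x, y, p, hp, rfl⟩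
  exact ⟨x, y, p, h.trans hp, rfl⟩

theorem geDegree_zero : geDegree k Q 0 = ⊤ := by
  refine eq_top_iff.2 fun f _ => ?_
  induction f using induction_path with
  | h0 => exact zero_mem _
  | hadd f g hf hg => exact add_mem (hf trivial) (hg trivial)
  | hpath c x y p => exact Submodule.smul_mem _ _ (ofPath_mem_geDegree p (Nat.zero_le _))

theorem geDegree_le_sup (n : ℕ) : geDegree k Q n ≤ degreePart k Q n ⊔ geDegree k Q (n + 1) := by
  refine Submodule.span_le.2 ?_
  rintro _ ⟨x, y, p, hp, rfl⟩
  rcases hp.eq_or_lt with h | h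
  · exact Submodule.mem_sup_left (h ▸ ofPath_mem_degreePart p)
  · exact Submodule.mem_sup_right (ofPath_mem_geDegree p h)

theorem mul_mem_of_span {S T : Set (PathAlgebra k Q)} {U : Submodule k (PathAlgebra k Q)}
    (h : ∀ s ∈ S, ∀ t ∈ T, s * t ∈ U) {f g : PathAlgebra k Q} (hf : f ∈ Submodule.span k S)
    (hg : g ∈ Submodule.span k T) : f * g ∈ U := by
  induction hf using Submodule.span_induction with
  | zero => simp
  | add f f' _ _ hf hf' => rw [add_mul]; exact add_mem hf hf'
  | smul c f _ hf => rw [smul_mul_assoc]; exact Submodule.smul_mem _ _ hf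
  | mem f hf =>
    induction hg using Submodule.span_induction with
    | zero => simp
    | add g g' _ _ hg hg' => rw [mul_add]; exact add_mem hg hg'
    | smul c g _ hg => rw [mul_smul_comm]; exact Submodule.smul_mem _ _ hg
    | mem g hg => exact h f hf g hg

theorem mul_mem_geDegree {m n : ℕ} {f g : PathAlgebra k Q} (hf : f ∈ geDegree k Q m)
    (hg : g ∈ geDegree k Q n) : f * g ∈ geDegree k Q (m + n) := by
  refine mul_mem_of_span ?_ hf hg
  rintro _ ⟨x, y, p, hp, rfl⟩ _ ⟨x', y', q, hq, rfl⟩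
  by_cases h : y' = x
  · subst h
    rw [ofPath_mul_ofPath]
    exact ofPath_mem_geDegree _ (by rw [Quiver.Path.length_comp]; omega)
  · rw [ofPath_mul_ofPath_of_ne _ _ h]
    exact zero_mem _

theorem mul_mem_degreePart {m n : ℕ} {f g : PathAlgebra k Q} (hf : f ∈ degreePart k Q m)
    (hg : g ∈ degreePart k Q n) : f * g ∈ degreePart k Q (m + n) := by
  refine mul_mem_of_span ?_ hf hg
  rintro _ ⟨x, y, p, hp, rfl⟩ _ ⟨x', y', q, hq, rfl⟩
  by_cases h : y' = x
  · subst h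
    rw [ofPath_mul_ofPath]
    exact Submodule.subset_span ⟨_, _, _, by rw [Quiver.Path.length_comp]; omega, rfl⟩
  · rw [ofPath_mul_ofPath_of_ne _ _ h]
    exact zero_mem _

theorem mul_mem_homPart {m n : ℕ} {x y z : Q} {f g : PathAlgebra k Q} (hf : f ∈ homPart k m y z)
    (hg : g ∈ homPart k n x y) : f * g ∈ homPart k (m + n) x z := by
  refine mul_mem_of_span ?_ hf hg
  rintro _ ⟨p, hp, rfl⟩ _ ⟨q, hq, rfl⟩
  rw [ofPath_mul_ofPath]
  exact Submodule.subset_span ⟨_, by rw [Quiver.Path.length_comp]; omega, rfl⟩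

theorem vertex_mul_of_mem_homPart {n : ℕ} {x y : Q} {f : PathAlgebra k Q}
    (hf : f ∈ homPart k n x y) : ofPath (Quiver.Path.nil : Quiver.Path y y) * f = f := by
  induction hf using Submodule.span_induction with
  | zero => simp
  | add f g _ _ hf hg => rw [mul_add, hf, hg]
  | smul c f _ hf => rw [mul_smul_comm, hf]
  | mem f hf =>
    obtain ⟨p, -, rfl⟩ := hf
    rw [ofPath_mul_ofPath, Quiver.Path.comp_nil]

theorem eq_zero_of_mem_degreePart_of_mem_geDegree {m n : ℕ} (h : m < n) {f : PathAlgebra k Q}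
    (hf : f ∈ degreePart k Q m) (hf' : f ∈ geDegree k Q n) : f = 0 := by
  refine ext_pathCoeff fun p => ?_
  rw [map_zero]
  by_cases hp : p.2.2.length = m
  · have : geDegree k Q n ≤ LinearMap.ker (pathCoeff p) := by
      refine Submodule.span_le.2 ?_
      rintro _ ⟨x, y, q, hq, rfl⟩
      refine pathCoeff_ofPath_of_ne q p ?_
      rintro rfl
      exact absurd (hp ▸ hq) (by omega)
    exact this hf'
  · have : degreePart k Q m ≤ LinearMap.ker (pathCoeff p) := by
      refine Submodule.span_le.2 ?_
      rintro _ ⟨x, y, q, hq, rfl⟩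
      refine pathCoeff_ofPath_of_ne q p ?_
      rintro rfl
      exact hp hq
    exact this hf

theorem pathCoeff_of_mem_geDegree {n : ℕ} {f : PathAlgebra k Q} (hf : f ∈ geDegree k Q n)
    (p : QPath Q) (hp : p.2.2.length < n) : pathCoeff p f = 0 := by
  have : geDegree k Q n ≤ LinearMap.ker (pathCoeff p) := by
    refine Submodule.span_le.2 ?_
    rintro _ ⟨x, y, q, hq, rfl⟩
    refine pathCoeff_ofPath_of_ne q p ?_
    rintro rfl
    exact absurd hq (by simpa using hp)
  exact this hf

/-- The two-sided ideal of `kQ` spanned by the paths of length at least `n`. -/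
def geDegreeIdeal (k : Type w) (Q : Type u) [Field k] [Quiver.{v} Q] (n : ℕ) :
    TwoSidedIdeal (PathAlgebra k Q) :=
  TwoSidedIdeal.mk' (geDegree k Q n) (zero_mem _) add_mem neg_mem
    (fun {x y} hy => by
      have := mul_mem_geDegree (m := 0) (f := x) (by rw [geDegree_zero]; trivial) hy
      rwa [zero_add] at this)
    (fun {x y} hx => by
      have := mul_mem_geDegree (n := 0) (g := y) hx (by rw [geDegree_zero]; trivial)
      rwa [add_zero] at this)

/-- The paths of length at least two span an ideal, and it contains the quadratic generators. This
inclusion is all that the proof uses about R being quadratic. -/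
theorem IsQuadratic.mem_geDegree {R : TwoSidedIdeal (PathAlgebra k Q)} (hR : IsQuadratic R)
    {f : PathAlgebra k Q} (hf : f ∈ R) : f ∈ geDegree k Q 2 := by
  obtain ⟨S, hS, rfl⟩ := hR
  have h : TwoSidedIdeal.span S ≤ geDegreeIdeal k Q 2 := by
    refine TwoSidedIdeal.span_le.2 fun s hs => ?_
    obtain ⟨x, y, h⟩ := hS s hs
    refine (TwoSidedIdeal.mem_mk' ..).2 ?_
    exact degreePart_le_geDegree _ (homPart_le_degreePart _ _ _ h)
  exact (TwoSidedIdeal.mem_mk' ..).1 (h hf)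

/-- Deleting the terminal arrow, in terms of coefficients. -/
theorem pathCoeff_strip {y x a : Q} (α : y ⟶ x) (δ : Quiver.Path a y) (f : PathAlgebra k Q) :
    pathCoeff ⟨a, y, δ⟩ (strip α f) = pathCoeff ⟨a, x, δ.cons α⟩ f := by
  induction f using induction_path with
  | h0 => simp
  | hadd f g hf hg => simp only [map_add, hf, hg]
  | hpath c s t p =>
    simp only [map_smul]
    congr 1
    cases p with
    | nil =>
      rw [strip_ofPath_nil, map_zero, pathCoeff_ofPath_of_ne]
      intro h
      have := congrArg (fun q : QPath Q => q.2.2.length) h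
      simp at this
    | @cons b _ p β =>
      by_cases h : (⟨b, t, β⟩ : Σ s t : Q, s ⟶ t) = ⟨y, x, α⟩
      · cases h
        rw [strip_ofPath_cons]
        by_cases h' : (⟨a, y, δ⟩ : QPath Q) = ⟨s, y, p⟩
        · cases h'
          rw [pathCoeff_ofPath_self, pathCoeff_ofPath_self]
        · rw [pathCoeff_ofPath_of_ne _ _ h', pathCoeff_ofPath_of_ne]
          intro h''
          cases h''
          exact h' rfl
      · rw [strip_ofPath_cons_of_ne α p β h, map_zero, pathCoeff_ofPath_of_ne]
        intro h''
        cases h''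
        exact h rfl

/-! ### Finiteness and expansions in a locally finite quiver -/

/-- Paths of given length starting at a given vertex of a locally finite quiver are finite in
number. -/
theorem finite_paths [Quiver.IsLocallyFinite Q] (a : Q) (n : ℕ) :
    {p : Σ y : Q, Quiver.Path a y | p.2.length = n}.Finite := by
  induction n with
  | zero =>
    refine (Set.finite_singleton (⟨a, Quiver.Path.nil⟩ : Σ y : Q, Quiver.Path a y)).subset ?_
    rintro ⟨y, p⟩ hp
    cases p with
    | nil => rfl
    | cons p α => simp at hp
  | succ n ih =>
    have hs := fun x : Q => Quiver.IsLocallyFinite.finite_star x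
    refine (ih.biUnion fun p _ => Set.finite_range fun α : Quiver.Star p.1 =>
      (⟨α.1, p.2.cons α.2⟩ : Σ y : Q, Quiver.Path a y)).subset ?_
    rintro ⟨y, p⟩ hp
    cases p with
    | nil => simp at hp
    | @cons b _ p α =>
      simp only [Set.mem_iUnion]
      exact ⟨⟨b, p⟩, by simpa using hp, ⟨y, α⟩, rfl⟩

/-- The paths of length `n` starting at `a`. -/
def pathsFrom [Quiver.IsLocallyFinite Q] (a : Q) (n : ℕ) : Finset (Σ y : Q, Quiver.Path a y) :=
  (finite_paths a n).toFinset

theorem mem_pathsFrom [Quiver.IsLocallyFinite Q] {a : Q} {n : ℕ} {p : Σ y : Q, Quiver.Path a y} :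
    p ∈ pathsFrom a n ↔ p.2.length = n := by
  simp [pathsFrom]

instance [Quiver.IsLocallyFinite Q] (x : Q) : Fintype (Quiver.Star x) :=
  letI := Quiver.IsLocallyFinite.finite_star x
  Fintype.ofFinite _

instance [Quiver.IsLocallyFinite Q] (x : Q) : Fintype (Quiver.Costar x) :=
  letI := Quiver.IsLocallyFinite.finite_costar x
  Fintype.ofFinite _

instance [Quiver.IsLocallyFinite Q] (n : ℕ) (a x : Q) : Module.Finite k (homPart k n a x) := by
  refine Module.Finite.span_of_finite k ?_
  refine ((finite_paths a n).image
    fun p => (ofPath p.2 : PathAlgebra k Q)).subset ?_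
  rintro _ ⟨p, hp, rfl⟩
  exact ⟨⟨x, p⟩, hp, rfl⟩

theorem exists_path_of_mem_homPart {n : ℕ} {a x : Q} {f : PathAlgebra k Q}
    (hf : f ∈ homPart k n a x) (h0 : f ≠ 0) : ∃ p : Quiver.Path a x, p.length = n := by
  by_contra h
  push Not at h
  have : {f : PathAlgebra k Q | ∃ p : Quiver.Path a x, p.length = n ∧ f = ofPath p} = ∅ := by
    ext f
    simp only [Set.mem_ofPred_eq, Set.mem_empty_iff_false, iff_false]
    rintro ⟨p, hp, -⟩
    exact h p hp
  rw [homPart, this, Submodule.span_empty, Submodule.mem_bot] at hf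
  exact h0 hf

/-- Expansion of an element of degree `n + 1` along the extensions `β δ` of the paths `δ` of
length `n`. -/
theorem eq_sum_pathCoeff_cons [Quiver.IsLocallyFinite Q] {n : ℕ} {a x : Q} {f : PathAlgebra k Q}
    (hf : f ∈ homPart k (n + 1) a x) :
    f = ∑ δ ∈ pathsFrom a n, ∑ β : Quiver.Star δ.1,
      pathCoeff ⟨a, β.1, δ.2.cons β.2⟩ f • (ofPath β.2.toPath * ofPath δ.2) := by
  induction hf using Submodule.span_induction with
  | zero => simp
  | add f g _ _ hf hg =>
    simp only [map_add, add_smul, Finset.sum_add_distrib]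
    rw [← hf, ← hg]
  | smul c f _ hf =>
    simp only [map_smul, smul_assoc, ← Finset.smul_sum]
    rw [← hf]
  | mem f hf =>
    obtain ⟨p, hp, rfl⟩ := hf
    cases p with
    | nil => simp at hp
    | @cons b _ p β =>
      rw [Finset.sum_eq_single (⟨b, p⟩ : Σ y : Q, Quiver.Path a y)]
      · rw [Finset.sum_eq_single (⟨x, β⟩ : Quiver.Star b)]
        · rw [pathCoeff_ofPath_self, one_smul, ofPath_mul_ofPath]
          rfl
        · rintro ⟨c, β'⟩ - h
          rw [pathCoeff_ofPath_of_ne, zero_smul]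
          intro h'
          cases h'
          exact h rfl
        · intro h
          exact absurd (Finset.mem_univ _) h
      · rintro ⟨b', p'⟩ - h
        refine Finset.sum_eq_zero fun β' _ => ?_
        rw [pathCoeff_ofPath_of_ne, zero_smul]
        intro h'
        cases h'
        exact h rfl
      · intro h
        exact absurd (mem_pathsFrom.2 (by simpa using hp)) h

/-- Expansion of an element of degree one. -/
theorem vertex_mul_eq_sum [Quiver.IsLocallyFinite Q] {f : PathAlgebra k Q}
    (hf : f ∈ degreePart k Q 1) (z : Q) :
    ofPath (Quiver.Path.nil : Quiver.Path z z) * f = ∑ α : Quiver.Costar z,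
      pathCoeff ⟨α.1, z, α.2.toPath⟩ f • ofPath α.2.toPath := by
  induction hf using Submodule.span_induction with
  | zero => simp
  | add f g _ _ hf hg =>
    simp only [map_add, add_smul, Finset.sum_add_distrib, mul_add]
    rw [← hf, ← hg]
  | smul c f _ hf =>
    simp only [map_smul, smul_assoc, ← Finset.smul_sum, mul_smul_comm]
    rw [← hf]
  | mem f hf =>
    obtain ⟨s, t, p, hp, rfl⟩ := hf
    obtain ⟨α, rfl⟩ : ∃ α : s ⟶ t, p = α.toPath := by
      cases p with
      | nil => simp at hp
      | cons p α =>
        cases p with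
        | nil => exact ⟨α, rfl⟩
        | cons p β => simp at hp
    by_cases h : t = z
    · subst h
      rw [ofPath_mul_ofPath, Quiver.Path.comp_nil,
        Finset.sum_eq_single (⟨s, α⟩ : Quiver.Costar t)]
      · rw [pathCoeff_ofPath_self, one_smul]
      · rintro ⟨c, β'⟩ - h
        rw [pathCoeff_ofPath_of_ne, zero_smul]
        intro h'
        cases h'
        exact h rfl
      · intro h
        exact absurd (Finset.mem_univ _) h
    · rw [ofPath_mul_ofPath_of_ne _ _ h]
      refine (Finset.sum_eq_zero fun β _ => ?_).symm
      rw [pathCoeff_ofPath_of_ne, zero_smul]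
      intro h'
      cases h'
      exact h rfl

theorem mul_vertex_eq_sum [Quiver.IsLocallyFinite Q] {f : PathAlgebra k Q}
    (hf : f ∈ degreePart k Q 1) (y : Q) :
    f * ofPath (Quiver.Path.nil : Quiver.Path y y) = ∑ α : Quiver.Star y,
      pathCoeff ⟨y, α.1, α.2.toPath⟩ f • ofPath α.2.toPath := by
  induction hf using Submodule.span_induction with
  | zero => simp
  | add f g _ _ hf hg =>
    simp only [map_add, add_smul, Finset.sum_add_distrib, add_mul]
    rw [← hf, ← hg]
  | smul c f _ hf =>
    simp only [map_smul, smul_assoc, ← Finset.smul_sum, smul_mul_assoc]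
    rw [← hf]
  | mem f hf =>
    obtain ⟨s, t, p, hp, rfl⟩ := hf
    obtain ⟨α, rfl⟩ : ∃ α : s ⟶ t, p = α.toPath := by
      cases p with
      | nil => simp at hp
      | cons p α =>
        cases p with
        | nil => exact ⟨α, rfl⟩
        | cons p β => simp at hp
    by_cases h : y = s
    · subst h
      rw [ofPath_mul_ofPath, Quiver.Path.nil_comp,
        Finset.sum_eq_single (⟨t, α⟩ : Quiver.Star y)]
      · rw [pathCoeff_ofPath_self, one_smul]
      · rintro ⟨c, β'⟩ - h
        rw [pathCoeff_ofPath_of_ne, zero_smul]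
        intro h'
        cases h'
        exact h rfl
      · intro h
        exact absurd (Finset.mem_univ _) h
    · rw [ofPath_mul_ofPath_of_ne _ _ h]
      refine (Finset.sum_eq_zero fun β _ => ?_).symm
      rw [pathCoeff_ofPath_of_ne, zero_smul]
      intro h'
      cases h'
      exact h rfl

end PathAlgebra

/-! ## Degrees in finite direct sums of the modules `Pₓ` -/

namespace BoundQuiver

open PathAlgebra

variable {k : Type w} {Q : Type u} [Field k] [Quiver.{v} Q] (R : TwoSidedIdeal (PathAlgebra k Q))

theorem bar_eq_zero {f : PathAlgebra k Q} : bar R f = 0 ↔ f ∈ R := by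
  have h1 : bar R f = ((toAlg R f : Alg R) : AlgOne R) := rfl
  rw [h1, ← Unitization.inr_zero k, Unitization.inr_injective.eq_iff]
  have h2 : toAlg R f = 0 ↔ R.ringCon f 0 := Quotient.eq''
  rw [h2, TwoSidedIdeal.mem_iff]

/-- The classes of the elements of `kQ` which are combinations of paths of length at least `n`. -/
def gePart (n : ℕ) : Submodule k (AlgOne R) := (geDegree k Q n).map (bar R)

/-- The scalar part of `u` preserves the filtration because it consists of subspaces; the part in Λ
does not lower path lengths. -/
theorem mul_mem_gePart_left (u : AlgOne R) {n : ℕ} {v : AlgOne R} (hv : v ∈ gePart R n) :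
    u * v ∈ gePart R n := by
  obtain ⟨g, hg, rfl⟩ := hv
  induction u using Unitization.ind with
  | inl_add_inr c l =>
  obtain ⟨f, rfl⟩ := toAlg_surjective R l
  rw [add_mul]
  refine add_mem ?_ ?_
  · have h : Unitization.inl c * bar R g = c • bar R g := (Algebra.smul_def c (bar R g)).symm
    rw [h]
    exact Submodule.smul_mem _ c ⟨g, hg, rfl⟩
  · refine ⟨f * g, ?_, bar_mul R f g⟩
    have := mul_mem_geDegree (m := 0) (f := f) (by rw [geDegree_zero]; trivial) hg
    rwa [zero_add] at this

theorem mul_mem_gePart {m n : ℕ} {u v : AlgOne R} (hu : u ∈ gePart R m) (hv : v ∈ gePart R n) :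
    u * v ∈ gePart R (m + n) := by
  obtain ⟨f, hf, rfl⟩ := hu
  obtain ⟨g, hg, rfl⟩ := hv
  exact ⟨f * g, mul_mem_geDegree hf hg, bar_mul R f g⟩

theorem mul_mem_gradedPart {m n : ℕ} {u v : AlgOne R} (hu : u ∈ gradedPart R m)
    (hv : v ∈ gradedPart R n) : u * v ∈ gradedPart R (m + n) := by
  obtain ⟨f, hf, rfl⟩ := hu
  obtain ⟨g, hg, rfl⟩ := hv
  exact ⟨f * g, mul_mem_degreePart hf hg, bar_mul R f g⟩

theorem gradedPart_le_gePart (n : ℕ) : gradedPart R n ≤ gePart R n :=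
  Submodule.map_mono (degreePart_le_geDegree n)

theorem idem_mem_gradedPart (x : Q) : idem R x ∈ gradedPart R 0 :=
  Submodule.mem_map_of_mem (ofPath_mem_degreePart (Quiver.Path.nil : Quiver.Path x x))

theorem arrow_mem_gradedPart {x y : Q} (α : x ⟶ y) : arrow R α ∈ gradedPart R 1 :=
  Submodule.mem_map_of_mem (ofPath_mem_degreePart α.toPath)

theorem idem_mul_idem (x : Q) : idem R x * idem R x = idem R x := by
  rw [idem, ← bar_mul, ofPath_mul_ofPath, Quiver.Path.comp_nil]

theorem mul_idem_of_mem_proj {x : Q} {u : AlgOne R} (hu : u ∈ proj R x) : u * idem R x = u := by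
  obtain ⟨c, rfl⟩ := Submodule.mem_span_singleton.1 hu
  rw [smul_eq_mul, mul_assoc, idem_mul_idem]

theorem proj_le_gePart {x : Q} {u : AlgOne R} (hu : u ∈ proj R x) : u ∈ gePart R 0 := by
  rw [← mul_idem_of_mem_proj R hu]
  exact mul_mem_gePart_left R u (gradedPart_le_gePart R 0 (idem_mem_gradedPart R x))

/-- Two representatives of `u` differ by an element of R, hence by paths of length at least two. For
n ≤ 1 this does not affect the component of degree n, so the comparison can be made in kQ. No
grading of Λ in higher degrees is needed. -/
theorem eq_zero_of_mem_gradedPart_of_mem_gePart (hR : IsQuadratic R) {n : ℕ} (hn : n ≤ 1)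
    {u : AlgOne R} (hu : u ∈ gradedPart R n) (hu' : u ∈ gePart R (n + 1)) : u = 0 := by
  obtain ⟨f, hf, rfl⟩ := hu
  obtain ⟨g, hg, hgf⟩ := hu'
  have h : f - g ∈ R := by
    rw [← bar_eq_zero, map_sub, hgf, sub_self]
  have h' : f ∈ geDegree k Q (n + 1) := by
    have := add_mem (geDegree_anti (by omega) (hR.mem_geDegree h)) hg
    rwa [sub_add_cancel] at this
  rw [eq_zero_of_mem_degreePart_of_mem_geDegree (Nat.lt_succ_self n) hf h', map_zero]

/-- The generator `eₓ` of `Pₓ`. -/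
def projGen (x : Q) : proj R x := ⟨idem R x, Ideal.subset_span rfl⟩

theorem smul_projGen {x : Q} (u : proj R x) : (u : AlgOne R) • projGen R x = u :=
  Subtype.ext (mul_idem_of_mem_proj R u.2)

/-! ### The ideal J and the submodules J M -/

/-- The image of the paths of positive length is a two-sided ideal containing the arrows. With
`toAlg_mem_radIdeal` this identifies J with that image. -/
theorem radIdeal_le {j : Alg R} (hj : j ∈ radIdeal R) : ∃ f ∈ geDegree k Q 1, toAlg R f = j := by
  let I : TwoSidedIdeal (Alg R) :=
    TwoSidedIdeal.mk' ((geDegree k Q 1).map (toAlgLinear R)) (zero_mem _) add_mem neg_mem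
    (fun {x y} hy => by
      obtain ⟨f, hf, rfl⟩ := hy
      obtain ⟨g, rfl⟩ := toAlg_surjective R x
      have := mul_mem_geDegree (m := 0) (f := g) (by rw [geDegree_zero]; trivial) hf
      rw [zero_add] at this
      exact ⟨_, this, rfl⟩)
    (fun {x y} hx => by
      obtain ⟨f, hf, rfl⟩ := hx
      obtain ⟨g, rfl⟩ := toAlg_surjective R y
      have := mul_mem_geDegree (n := 0) (g := g) hf (by rw [geDegree_zero]; trivial)
      rw [add_zero] at this
      exact ⟨_, this, rfl⟩)
  have h : radIdeal R ≤ I := by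
    refine TwoSidedIdeal.span_le.2 ?_
    rintro _ ⟨x, y, α, rfl⟩
    exact (TwoSidedIdeal.mem_mk' ..).2 ⟨_, ofPath_mem_geDegree _ (le_refl 1), rfl⟩
  have h' : j ∈ (geDegree k Q 1).map (toAlgLinear R) := (TwoSidedIdeal.mem_mk' ..).1 (h hj)
  exact h'

theorem toAlg_mem_radIdeal {f : PathAlgebra k Q} (hf : f ∈ geDegree k Q 1) :
    toAlg R f ∈ radIdeal R := by
  induction hf using Submodule.span_induction with
  | zero => exact (radIdeal R).zero_mem
  | add f g _ _ hf hg => exact (radIdeal R).add_mem hf hg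
  | smul c f _ hf =>
    -- Without an identity in Λ, closure of J under scalars is not part of being an ideal. It
    -- follows from c f = f (c e), with e a local right identity of f.
    obtain ⟨S, hS⟩ := exists_local_unit f
    rw [← hS S subset_rfl, ← mul_smul_comm]
    exact (radIdeal R).mul_mem_right _ (toAlg R _) hf
  | mem f hf =>
    obtain ⟨x, y, p, hp, rfl⟩ := hf
    cases p with
    | nil => simp at hp
    | cons p α =>
      have h : (ofPath (p.cons α) : PathAlgebra k Q) = ofPath α.toPath * ofPath p := by
        rw [ofPath_mul_ofPath]; rfl
      rw [h]
      exact (radIdeal R).mul_mem_right _ (toAlg R (ofPath p)) (TwoSidedIdeal.subset_span ⟨_, _, α, rfl⟩)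

/-- A path of positive length is a left multiple of its initial arrow: terminal arrows are peeled
off until one arrow is left. -/
theorem gePart_one_le_span {u : AlgOne R} (hu : u ∈ gePart R 1) :
    u ∈ Submodule.span (AlgOne R) (gradedPart R 1 : Set (AlgOne R)) := by
  obtain ⟨f, hf, rfl⟩ := hu
  induction hf using Submodule.span_induction with
  | zero => simp
  | add f g _ _ hf hg => rw [map_add]; exact add_mem hf hg
  | smul c f _ hf =>
    rw [map_smul, Algebra.smul_def]
    exact Submodule.smul_mem _ _ hf
  | mem f hf =>
    obtain ⟨x, y, p, hp, rfl⟩ := hf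
    induction p with
    | nil => simp at hp
    | @cons b c p α ih =>
      have h : (ofPath (p.cons α) : PathAlgebra k Q) = ofPath α.toPath * ofPath p := by
        rw [ofPath_mul_ofPath]; rfl
      by_cases h0 : p.length = 0
      · refine Submodule.subset_span ⟨_, ?_, rfl⟩
        have := ofPath_mem_degreePart (k := k) (p.cons α)
        rwa [Quiver.Path.length_cons, h0] at this
      · rw [h, bar_mul]
        exact Submodule.smul_mem _ _ (ih (by omega))

theorem mul_mem_gePart_one {j : Alg R} (hj : j ∈ radIdeal R) {u : AlgOne R}
    (hu : u ∈ gePart R 0) : (j : AlgOne R) * u ∈ gePart R 1 := by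
  obtain ⟨f, hf, rfl⟩ := radIdeal_le R hj
  exact mul_mem_gePart R (m := 1) (n := 0) ⟨f, hf, rfl⟩ hu

theorem mem_gePart_of_mem_radMul_proj {x : Q} {u : proj R x} (hu : u ∈ radMul R (proj R x)) :
    (u : AlgOne R) ∈ gePart R 1 := by
  induction hu using Submodule.span_induction with
  | zero => exact zero_mem _
  | add u v _ _ hu hv => exact add_mem hu hv
  | smul c u _ hu => exact mul_mem_gePart_left R c hu
  | mem u hu =>
    obtain ⟨j, hj, p, rfl⟩ := hu
    exact mul_mem_gePart_one R hj (proj_le_gePart R p.2)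

theorem mem_radMul_proj {x : Q} {u : proj R x} (hu : (u : AlgOne R) ∈ gePart R 1) :
    u ∈ radMul R (proj R x) := by
  obtain ⟨f, hf, hfu⟩ := hu
  rw [← smul_projGen R u, ← hfu]
  exact Submodule.subset_span ⟨toAlg R f, toAlg_mem_radIdeal R hf, _, rfl⟩

theorem mem_radMul_map {M N : Type*} [AddCommGroup M] [Module (AlgOne R) M] [AddCommGroup N]
    [Module (AlgOne R) N] (f : M →ₗ[AlgOne R] N) {m : M} (hm : m ∈ radMul R M) :
    f m ∈ radMul R N := by
  induction hm using Submodule.span_induction with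
  | zero => simp
  | add u v _ _ hu hv => rw [map_add]; exact add_mem hu hv
  | smul c u _ hu => rw [map_smul]; exact Submodule.smul_mem _ _ hu
  | mem u hu =>
    obtain ⟨j, hj, p, rfl⟩ := hu
    rw [map_smul]
    exact Submodule.subset_span ⟨j, hj, f p, rfl⟩

theorem radMul_simple (a : Q) : radMul R (simple R a) = ⊥ := by
  refine eq_bot_iff.2 (Submodule.span_le.2 ?_)
  rintro _ ⟨j, hj, p, rfl⟩
  obtain ⟨p, rfl⟩ := Submodule.mkQ_surjective _ p
  rw [← map_smul]
  exact (Submodule.Quotient.mk_eq_zero _).2 (Submodule.subset_span ⟨j, hj, p, rfl⟩)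

/-- Right multiplication by eₓ retracts the algebra with adjoined identity onto Pₓ. -/
instance (x : Q) : Module.Projective (AlgOne R) (proj R x) :=
  Module.Projective.of_split (M := AlgOne R) (proj R x).subtype
    { toFun := fun u => ⟨u * idem R x, Ideal.mul_mem_left _ _ (Ideal.subset_span rfl)⟩
      map_add' := fun _ _ => Subtype.ext (add_mul _ _ _)
      map_smul' := fun _ _ => Subtype.ext (mul_assoc _ _ _) }
    (LinearMap.ext fun u => Subtype.ext (mul_idem_of_mem_proj R u.2))

/-! ### Degrees zero and one in finite direct sums of the Pₓ -/

variable {m : ℕ} (x : Fin m → Q)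

/-- The generators of a finite direct sum `P_{x 1} ⊕ ⋯ ⊕ P_{x m}`. -/
def sumGen (i : Fin m) : projSum R x := Pi.single i (projGen R (x i))

variable {R x}

theorem eq_sum_smul_sumGen (v : projSum R x) : v = ∑ i, (v i : AlgOne R) • sumGen R x i := by
  classical
  conv_lhs => rw [← Finset.univ_sum_single v]
  refine Finset.sum_congr rfl fun i _ => ?_
  rw [sumGen, ← Pi.single_smul, smul_projGen]

theorem sumGen_mem (i : Fin m) : sumGen R x i ∈ projSumDegree R x 0 := by
  classical
  intro j
  by_cases h : j = i
  · subst h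
    rw [sumGen, Pi.single_eq_same]
    exact idem_mem_gradedPart R _
  · rw [sumGen, Pi.single_eq_of_ne h]
    exact zero_mem _

theorem sum_mem_projSumDegree {ι : Type*} (s : Finset ι) {v : ι → projSum R x} {n : ℕ}
    (h : ∀ i ∈ s, v i ∈ projSumDegree R x n) : ∑ i ∈ s, v i ∈ projSumDegree R x n := by
  intro j
  rw [Finset.sum_apply, AddSubmonoidClass.coe_finsetSum]
  exact sum_mem fun i hi => h i hi j

theorem sub_mem_projSumDegree {v w : projSum R x} {n : ℕ} (hv : v ∈ projSumDegree R x n)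
    (hw : w ∈ projSumDegree R x n) : v - w ∈ projSumDegree R x n :=
  fun j => sub_mem (hv j) (hw j)

theorem smul_mem_projSumDegree {v : projSum R x} {n i : ℕ} (hv : v ∈ projSumDegree R x n)
    {u : AlgOne R} (hu : u ∈ gradedPart R i) : u • v ∈ projSumDegree R x (i + n) :=
  fun j => mul_mem_gradedPart R hu (hv j)

theorem linearMap_ext_sumGen {L : Type*} [AddCommGroup L] [Module (AlgOne R) L]
    {f g : projSum R x →ₗ[AlgOne R] L} (h : ∀ i, f (sumGen R x i) = g (sumGen R x i)) : f = g := by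
  refine LinearMap.ext fun v => ?_
  change f v = g v
  rw [eq_sum_smul_sumGen v, map_sum, map_sum]
  exact Finset.sum_congr rfl fun i _ => by rw [map_smul, map_smul, h]

theorem map_mem_projSumDegree {m' : ℕ} {y : Fin m' → Q} (f : projSum R x →ₗ[AlgOne R] projSum R y)
    {n : ℕ} (hf : ∀ i, f (sumGen R x i) ∈ projSumDegree R y n) (i : ℕ) {v : projSum R x}
    (hv : v ∈ projSumDegree R x i) : f v ∈ projSumDegree R y (i + n) := by
  rw [eq_sum_smul_sumGen v, map_sum]
  refine sum_mem_projSumDegree _ fun j _ => ?_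
  rw [map_smul]
  exact smul_mem_projSumDegree (hf j) (hv j)

theorem map_mem_gePart {m' : ℕ} {y : Fin m' → Q} (f : projSum R x →ₗ[AlgOne R] projSum R y)
    {n : ℕ} (hf : ∀ i, f (sumGen R x i) ∈ projSumDegree R y n) {i : ℕ} {v : projSum R x}
    (hv : ∀ j, (v j : AlgOne R) ∈ gePart R i) (j : Fin m') :
    (f v j : AlgOne R) ∈ gePart R (i + n) := by
  rw [eq_sum_smul_sumGen v, map_sum, Finset.sum_apply, AddSubmonoidClass.coe_finsetSum]
  refine sum_mem fun l _ => ?_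
  rw [map_smul]
  exact mul_mem_gePart R (hv l) (gradedPart_le_gePart R n (hf l j))

theorem mem_radMul_iff {v : projSum R x} :
    v ∈ radMul R (projSum R x) ↔ ∀ i, (v i : AlgOne R) ∈ gePart R 1 := by
  constructor
  · intro hv i
    exact mem_gePart_of_mem_radMul_proj R
      (mem_radMul_map R (LinearMap.proj i : projSum R x →ₗ[AlgOne R] proj R (x i)) hv)
  · intro hv
    rw [eq_sum_smul_sumGen v]
    refine sum_mem fun i _ => ?_
    obtain ⟨f, hf, hfv⟩ := hv i
    rw [← hfv]
    exact Submodule.subset_span ⟨toAlg R f, toAlg_mem_radIdeal R hf, _, rfl⟩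

/-- This turns statements about J P into statements about degree one, the only degree that a
diagonal complex controls. -/
theorem mem_span_degree_one {v : projSum R x} (hv : v ∈ radMul R (projSum R x)) :
    v ∈ Submodule.span (AlgOne R) (projSumDegree R x 1) := by
  rw [eq_sum_smul_sumGen v]
  refine sum_mem fun i _ => ?_
  have h : Submodule.span (AlgOne R) (gradedPart R 1 : Set (AlgOne R)) ≤
      (Submodule.span (AlgOne R) (projSumDegree R x 1)).comap
        (LinearMap.toSpanSingleton (AlgOne R) _ (sumGen R x i)) := by
    refine Submodule.span_le.2 fun u hu => ?_
    refine Submodule.subset_span ?_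
    rw [LinearMap.toSpanSingleton_apply]
    exact smul_mem_projSumDegree (sumGen_mem i) hu
  exact h (gePart_one_le_span R (mem_radMul_iff.1 hv i))

theorem degree_one_le_radMul {v : projSum R x} (hv : v ∈ projSumDegree R x 1) :
    v ∈ radMul R (projSum R x) :=
  mem_radMul_iff.2 fun i => gradedPart_le_gePart R 1 (hv i)

theorem eq_zero_of_degree_zero_of_radMul (hR : IsQuadratic R) {v : projSum R x}
    (hv : v ∈ projSumDegree R x 0) (hv' : v ∈ radMul R (projSum R x)) : v = 0 :=
  funext fun i => Subtype.ext <| eq_zero_of_mem_gradedPart_of_mem_gePart R hR zero_le_one (hv i)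
    (mem_radMul_iff.1 hv' i)

/-- Every element is the sum of an element of degree zero and one in `J M`. -/
theorem exists_degree_zero_add (v : projSum R x) :
    ∃ v₀ ∈ projSumDegree R x 0, ∃ v₁ ∈ radMul R (projSum R x), v = v₀ + v₁ := by
  have key : ∀ y : Q, ∀ u : proj R y, ∃ u₀ u₁ : proj R y, (u₀ : AlgOne R) ∈ gradedPart R 0 ∧
      (u₁ : AlgOne R) ∈ gePart R 1 ∧ u = u₀ + u₁ := by
    intro y u
    obtain ⟨f, hf, hfu⟩ := proj_le_gePart R u.2
    obtain ⟨f₀, h₀, f₁, h₁, rfl⟩ := Submodule.mem_sup.1 (geDegree_le_sup 0 hf)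
    have hy : idem R y ∈ proj R y := Ideal.subset_span rfl
    refine ⟨⟨bar R f₀ * idem R y, Ideal.mul_mem_left _ _ hy⟩,
      ⟨bar R f₁ * idem R y, Ideal.mul_mem_left _ _ hy⟩,
      mul_mem_gradedPart R (m := 0) (n := 0) ⟨f₀, h₀, rfl⟩ (idem_mem_gradedPart R y),
      mul_mem_gePart R (m := 1) (n := 0) ⟨f₁, h₁, rfl⟩
        (gradedPart_le_gePart R 0 (idem_mem_gradedPart R y)), Subtype.ext ?_⟩
    change (u : AlgOne R) = bar R f₀ * idem R y + bar R f₁ * idem R y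
    rw [← add_mul, ← map_add, hfu, mul_idem_of_mem_proj R u.2]
  choose u₀ u₁ h₀ h₁ h using fun i => key (x i) (v i)
  exact ⟨u₀, h₀, u₁, mem_radMul_iff.2 h₁, funext h⟩

/-! ### Lifts and isomorphisms determined in degree zero -/

/-- Lifting through maps between finite direct sums of the `Pₓ`, in degree zero. -/
theorem exists_lift {m' : ℕ} {y : Fin m' → Q} {L : Type*} [AddCommGroup L] [Module (AlgOne R) L]
    (f : projSum R x →ₗ[AlgOne R] L) (g : projSum R y →ₗ[AlgOne R] L)
    (h : f '' projSumDegree R x 0 ⊆ g '' projSumDegree R y 0) :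
    ∃ e : projSum R x →ₗ[AlgOne R] projSum R y, (∀ v, g (e v) = f v) ∧
      ∀ v ∈ projSumDegree R x 0, e v ∈ projSumDegree R y 0 := by
  choose w hw hgw using fun i => h ⟨sumGen R x i, sumGen_mem i, rfl⟩
  let e : projSum R x →ₗ[AlgOne R] projSum R y :=
    ∑ i, (LinearMap.toSpanSingleton (AlgOne R) _ (w i)).comp
      ((proj R (x i)).subtype.comp (LinearMap.proj i))
  have he : ∀ v, e v = ∑ i, (v i : AlgOne R) • w i := fun v => by
    simp only [e, LinearMap.sum_apply]
    rfl
  refine ⟨e, fun v => ?_, fun v hv => ?_⟩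
  · rw [he, map_sum]
    conv_rhs => rw [eq_sum_smul_sumGen v, map_sum]
    exact Finset.sum_congr rfl fun i _ => by rw [map_smul, map_smul, hgw]
  · rw [he]
    exact sum_mem_projSumDegree _ fun i _ => smul_mem_projSumDegree (hw i) (hv i)

/-- Two finite direct sums of the `Pₓ` mapping injectively onto the same subspace in degree zero are
isomorphic. -/
theorem exists_equiv {m' : ℕ} {y : Fin m' → Q} {L : Type*} [AddCommGroup L] [Module (AlgOne R) L]
    (f : projSum R x →ₗ[AlgOne R] L) (g : projSum R y →ₗ[AlgOne R] L)
    (h : f '' projSumDegree R x 0 = g '' projSumDegree R y 0)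
    (hf : Set.InjOn f (projSumDegree R x 0)) (hg : Set.InjOn g (projSumDegree R y 0)) :
    ∃ e : projSum R x ≃ₗ[AlgOne R] projSum R y, (∀ v, g (e v) = f v) ∧
      (∀ v ∈ projSumDegree R x 0, e v ∈ projSumDegree R y 0) ∧
      ∀ v ∈ projSumDegree R y 0, e.symm v ∈ projSumDegree R x 0 := by
  obtain ⟨e, he, he0⟩ := exists_lift f g h.subset
  obtain ⟨e', he', he0'⟩ := exists_lift g f h.superset
  -- Both composites preserve degree zero and commute with the maps to L, so injectivity in degree
  -- zero forces them to fix the generators.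
  have h1 : e'.comp e = LinearMap.id := linearMap_ext_sumGen fun i =>
    hf (he0' _ (he0 _ (sumGen_mem i))) (sumGen_mem i) ((he' _).trans (he _))
  have h2 : e.comp e' = LinearMap.id := linearMap_ext_sumGen fun i =>
    hg (he0 _ (he0' _ (sumGen_mem i))) (sumGen_mem i) ((he _).trans (he' _))
  exact ⟨LinearEquiv.ofLinearMap e e' h2 h1, he, he0, he0'⟩

theorem map_degree_of_map_degree_zero {m' : ℕ} {y : Fin m' → Q}
    (e : projSum R x →ₗ[AlgOne R] projSum R y)
    (he : ∀ v ∈ projSumDegree R x 0, e v ∈ projSumDegree R y 0) (n : ℕ) {v : projSum R x}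
    (hv : v ∈ projSumDegree R x n) : e v ∈ projSumDegree R y n :=
  map_mem_projSumDegree e (fun i => he _ (sumGen_mem i)) n hv

theorem injOn_of_eq_zero {m : ℕ} {x : Fin m → Q} {L : Type*} [AddCommGroup L]
    [Module (AlgOne R) L] (f : projSum R x →ₗ[AlgOne R] L)
    (hf : ∀ v ∈ projSumDegree R x 0, f v = 0 → v = 0) : Set.InjOn f (projSumDegree R x 0) := by
  intro v hv w hw h
  rw [← sub_eq_zero]
  exact hf _ (sub_mem_projSumDegree hv hw) (by rw [map_sub, h, sub_self])

/-- Injectivity in degree zero. -/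
theorem injOn_of_ker_le_radMul (hR : IsQuadratic R) {L : Type*} [AddCommGroup L]
    [Module (AlgOne R) L] (f : projSum R x →ₗ[AlgOne R] L)
    (hf : LinearMap.ker f ≤ radMul R (projSum R x)) : Set.InjOn f (projSumDegree R x 0) := by
  intro v hv w hw h
  rw [← sub_eq_zero]
  refine eq_zero_of_degree_zero_of_radMul hR (sub_mem_projSumDegree hv hw) (hf ?_)
  rw [LinearMap.mem_ker, map_sub, h, sub_self]

/-! ### Diagonal complexes -/

/-- A complex of finite direct sums of the `Pₓ`, augmented to a module `M` with `J M = 0`, in which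
every differential maps the degree zero part bijectively onto the part of degree one of the kernel
of the next differential. -/
structure IsDiagonal {M : Type*} [AddCommGroup M] [Module (AlgOne R) M] {rank : ℕ → ℕ}
    {vertex : ∀ n, Fin (rank n) → Q}
    (d : ∀ n, projSum R (vertex (n + 1)) →ₗ[AlgOne R] projSum R (vertex n))
    (aug : projSum R (vertex 0) →ₗ[AlgOne R] M) : Prop where
  aug_surjective : Function.Surjective aug
  injOn_aug : Set.InjOn aug (projSumDegree R (vertex 0) 0)
  injOn : ∀ n, Set.InjOn (d n) (projSumDegree R (vertex (n + 1)) 0)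
  image_zero : d 0 '' projSumDegree R (vertex 1) 0 =
    projSumDegree R (vertex 0) 1 ∩ {v | aug v = 0}
  image_succ : ∀ n, d (n + 1) '' projSumDegree R (vertex (n + 2)) 0 =
    projSumDegree R (vertex (n + 1)) 1 ∩ {v | d n v = 0}

section IsDiagonal

variable {M : Type*} [AddCommGroup M] [Module (AlgOne R) M] {rank : ℕ → ℕ}
  {vertex : ∀ n, Fin (rank n) → Q}
  {d : ∀ n, projSum R (vertex (n + 1)) →ₗ[AlgOne R] projSum R (vertex n)}
  {aug : projSum R (vertex 0) →ₗ[AlgOne R] M}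

theorem aug_eq_zero_of_radMul (hM : radMul R M = ⊥) (aug : projSum R x →ₗ[AlgOne R] M)
    {v : projSum R x} (hv : v ∈ radMul R (projSum R x)) : aug v = 0 := by
  have := mem_radMul_map R aug hv
  rwa [hM, Submodule.mem_bot] at this

/-- Since J M = 0, the component in J P contributes nothing to the image. Two augmentations onto M
thus agree on degree zero images, which starts the comparison of diagonal complexes. -/
theorem image_aug_degree_zero (hM : radMul R M = ⊥) {aug : projSum R x →ₗ[AlgOne R] M}
    (h : Function.Surjective aug) : aug '' projSumDegree R x 0 = Set.univ := by
  refine Set.eq_univ_of_forall fun z => ?_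
  obtain ⟨v, rfl⟩ := h z
  obtain ⟨v₀, h₀, v₁, h₁, rfl⟩ := exists_degree_zero_add v
  exact ⟨v₀, h₀, by rw [map_add, aug_eq_zero_of_radMul hM aug h₁, add_zero]⟩

theorem IsDiagonal.d_sumGen_mem (h : IsDiagonal d aug) (n : ℕ) (i : Fin (rank (n + 1))) :
    d n (sumGen R (vertex (n + 1)) i) ∈ projSumDegree R (vertex n) 1 := by
  have h1 : d n (sumGen R (vertex (n + 1)) i) ∈ d n '' projSumDegree R (vertex (n + 1)) 0 :=
    ⟨_, sumGen_mem i, rfl⟩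
  cases n with
  | zero => rw [h.image_zero] at h1; exact h1.1
  | succ n => rw [h.image_succ] at h1; exact h1.1

theorem IsDiagonal.comp_zero (h : IsDiagonal d aug) : aug.comp (d 0) = 0 := by
  refine linearMap_ext_sumGen fun i => ?_
  have h1 : d 0 (sumGen R (vertex 1) i) ∈ d 0 '' projSumDegree R (vertex 1) 0 :=
    ⟨_, sumGen_mem i, rfl⟩
  rw [h.image_zero] at h1
  exact h1.2

/-- The augmentation kills J P⁰ and is injective in degree zero, so its kernel is exactly J P⁰. This
is generated in degree one, and all of degree one lies in the image of `d 0`. -/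
theorem IsDiagonal.exact_zero (hM : radMul R M = ⊥) (h : IsDiagonal d aug) :
    Function.Exact (d 0) aug := by
  refine LinearMap.exact_iff.2 (le_antisymm ?_ ?_)
  · intro v hv
    obtain ⟨v₀, h₀, v₁, h₁, rfl⟩ := exists_degree_zero_add v
    have h2 : v₀ = 0 := by
      refine h.injOn_aug h₀ (fun _ => zero_mem _) ?_
      rwa [LinearMap.mem_ker, map_add, aug_eq_zero_of_radMul hM aug h₁, add_zero,
        ← map_zero aug] at hv
    have h5 : v₀ + v₁ = v₁ := by rw [h2, zero_add]
    rw [h5]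
    have h3 : Submodule.span (AlgOne R) (projSumDegree R (vertex 0) 1) ≤
        LinearMap.range (d 0) := by
      refine Submodule.span_le.2 fun w hw => ?_
      have h4 : w ∈ projSumDegree R (vertex 0) 1 ∩ {v | aug v = 0} :=
        ⟨hw, aug_eq_zero_of_radMul hM aug (degree_one_le_radMul hw)⟩
      rw [← h.image_zero] at h4
      obtain ⟨z, -, hz⟩ := h4
      exact ⟨z, hz⟩
    exact h3 (mem_span_degree_one h₁)
  · rintro _ ⟨w, rfl⟩
    exact LinearMap.congr_fun h.comp_zero w

theorem IsDiagonal.range_le_radMul (h : IsDiagonal d aug) (n : ℕ) :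
    LinearMap.range (d n) ≤ radMul R (projSum R (vertex n)) := by
  rintro _ ⟨v, rfl⟩
  rw [eq_sum_smul_sumGen v, map_sum]
  refine sum_mem fun i _ => ?_
  rw [map_smul]
  exact Submodule.smul_mem _ _ (degree_one_le_radMul (h.d_sumGen_mem n i))

/-- An exact diagonal complex is a linear projective resolution. -/
def IsDiagonal.toResolution (hM : radMul R M = ⊥) (h : IsDiagonal d aug)
    (hd : ∀ n, Function.Exact (d (n + 1)) (d n)) : LinearProjectiveResolution R M where
  rank := rank
  vertex := vertex
  d := d
  aug := aug
  aug_surjective := h.aug_surjective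
  exact_zero := h.exact_zero hM
  exact_succ := hd
  minimal_zero := by
    rw [LinearMap.exact_iff.1 (h.exact_zero hM)]
    exact h.range_le_radMul 0
  -- By exactness the kernel is the image of the next differential, which sends generators to degree
  -- one and so has its image in J P.
  minimal_succ n := by
    rw [LinearMap.exact_iff.1 (hd n)]
    exact h.range_le_radMul (n + 1)
  linear n i _ hv := map_mem_projSumDegree (d n) (h.d_sumGen_mem n) i hv

/-- The image of the degree zero part in an exact sequence with homogeneous maps. -/
theorem image_degree_zero_of_exact (hR : IsQuadratic R) {m' : ℕ} {y : Fin m' → Q} {L : Type*}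
    [AddCommGroup L] [Module (AlgOne R) L] {f : projSum R x →ₗ[AlgOne R] projSum R y}
    {g : projSum R y →ₗ[AlgOne R] L} (h : Function.Exact f g)
    (hf : ∀ v ∈ projSumDegree R x 0, f v ∈ projSumDegree R y 1) :
    f '' projSumDegree R x 0 = projSumDegree R y 1 ∩ {v | g v = 0} := by
  refine Set.Subset.antisymm ?_ ?_
  · rintro _ ⟨v, hv, rfl⟩
    exact ⟨hf v hv, h.apply_apply_eq_zero v⟩
  · rintro v ⟨hv1, hv2⟩
    obtain ⟨w, rfl⟩ := (h v).1 hv2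
    -- The remainder `f w₁` has degree one as a difference of degree one elements, but is also a
    -- class of paths of length at least two because `w₁` lies in J P. Hence it vanishes and `w₀` is
    -- already a preimage.
    obtain ⟨w₀, h₀, w₁, h₁, rfl⟩ := exists_degree_zero_add w
    refine ⟨w₀, h₀, ?_⟩
    rw [map_add, left_eq_add]
    have h2 : f w₁ ∈ projSumDegree R y 1 := by
      have := sub_mem_projSumDegree hv1 (hf _ h₀)
      rwa [map_add, add_sub_cancel_left] at this
    have h3 := map_mem_gePart f (fun i => hf _ (sumGen_mem i)) (mem_radMul_iff.1 h₁)
    exact funext fun j => Subtype.ext <|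
      eq_zero_of_mem_gradedPart_of_mem_gePart R hR le_rfl (h2 j) (h3 j)

/-- A kernel inside J P meets degree zero only in 0, which gives injectivity there. -/
theorem LinearProjectiveResolution.isDiagonal (hR : IsQuadratic R)
    (P : LinearProjectiveResolution R M) : IsDiagonal P.d P.aug where
  aug_surjective := P.aug_surjective
  injOn_aug := injOn_of_ker_le_radMul hR _ P.minimal_zero
  injOn n := injOn_of_ker_le_radMul hR _ (P.minimal_succ n)
  image_zero := image_degree_zero_of_exact hR P.exact_zero fun v hv => P.linear 0 0 v hv
  image_succ n := image_degree_zero_of_exact hR (P.exact_succ n)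
    fun v hv => P.linear (n + 1) 0 v hv

/-- Exactness is transported along an isomorphism in degree zero. -/
theorem exact_of_degree_one_generated {m' p p' : ℕ} {y : Fin m' → Q} {z : Fin p → Q}
    {z' : Fin p' → Q} {L L' : Type*} [AddCommGroup L] [Module (AlgOne R) L] [AddCommGroup L']
    [Module (AlgOne R) L'] {f : projSum R z →ₗ[AlgOne R] L} {g : projSum R z' →ₗ[AlgOne R] L'}
    (e : projSum R z ≃ₗ[AlgOne R] projSum R z')
    (he : ∀ v ∈ projSumDegree R z 0, e v ∈ projSumDegree R z' 0)
    (he' : ∀ v ∈ projSumDegree R z' 0, e.symm v ∈ projSumDegree R z 0)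
    (hfg : ∀ v, g (e v) = 0 ↔ f v = 0)
    {f' : projSum R x →ₗ[AlgOne R] projSum R z} {g' : projSum R y →ₗ[AlgOne R] projSum R z'}
    (hf' : f' '' projSumDegree R x 0 = projSumDegree R z 1 ∩ {v | f v = 0})
    (hg' : g' '' projSumDegree R y 0 = projSumDegree R z' 1 ∩ {v | g v = 0}) :
    (fun v => e (f' v)) '' projSumDegree R x 0 = g' '' projSumDegree R y 0 ∧
      (Function.Exact g' g → Function.Exact f' f) := by
  -- Both images are degree one parts of kernels, and `e` matches degrees and kernels.
  have key : ∀ v, v ∈ f' '' projSumDegree R x 0 ↔ e v ∈ g' '' projSumDegree R y 0 := by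
    intro v
    rw [hf', hg']
    refine and_congr ⟨map_degree_of_map_degree_zero e.toLinearMap he 1, fun h => ?_⟩ (hfg v).symm
    have := map_degree_of_map_degree_zero e.symm.toLinearMap he' 1 h
    simpa using this
  refine ⟨?_, fun h => LinearMap.exact_iff.2 (le_antisymm ?_ ?_)⟩
  · ext w
    obtain ⟨v, rfl⟩ := e.surjective w
    rw [← key]
    constructor
    · rintro ⟨v', hv', h⟩
      exact ⟨v', hv', e.injective h⟩
    · rintro ⟨v', hv', rfl⟩
      exact ⟨v', hv', rfl⟩
  · intro v hv
    obtain ⟨w, hw⟩ := (h (e v)).1 ((hfg v).2 hv)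
    have h1 : v = e.symm (g' w) := by rw [hw, e.symm_apply_apply]
    rw [h1, eq_sum_smul_sumGen w, map_sum, map_sum]
    refine sum_mem fun i _ => ?_
    rw [map_smul, map_smul]
    refine Submodule.smul_mem _ _ ?_
    -- Generators suffice: `g'` sends each of them into its degree zero image, which `key`
    -- transports back to the image of `f'`.
    have h2 := (key (e.symm (g' (sumGen R y i)))).2
      (by rw [e.apply_symm_apply]; exact ⟨_, sumGen_mem i, rfl⟩)
    obtain ⟨v', -, h3⟩ := h2
    exact ⟨v', h3⟩
  · rintro _ ⟨v, rfl⟩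
    rw [eq_sum_smul_sumGen v, map_sum]
    refine sum_mem fun i _ => ?_
    rw [map_smul]
    refine Submodule.smul_mem _ _ ?_
    have : f' (sumGen R x i) ∈ f' '' projSumDegree R x 0 := ⟨_, sumGen_mem i, rfl⟩
    rw [hf'] at this
    exact this.2

/-- If `M` has a linear projective resolution, every diagonal complex augmented to `M` is exact. -/
theorem IsDiagonal.exact_of_resolution (hR : IsQuadratic R) (hM : radMul R M = ⊥)
    (h : IsDiagonal d aug) (P : LinearProjectiveResolution R M) (n : ℕ) :
    Function.Exact (d (n + 1)) (d n) := by
  have hP := P.isDiagonal hR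
  obtain ⟨e₀, he₀, he₁, he₂⟩ := exists_equiv aug P.aug
    ((image_aug_degree_zero hM h.aug_surjective).trans
      (image_aug_degree_zero hM P.aug_surjective).symm) h.injOn_aug hP.injOn_aug
  -- The new isomorphism commutes with the differentials up to `e`; only the resulting
  -- correspondence of kernels is needed to continue.
  have next : ∀ (n : ℕ) (e : projSum R (vertex n) ≃ₗ[AlgOne R] projSum R (P.vertex n)),
      (fun v => e (d n v)) '' projSumDegree R (vertex (n + 1)) 0 =
        P.d n '' projSumDegree R (P.vertex (n + 1)) 0 →
      ∃ e' : projSum R (vertex (n + 1)) ≃ₗ[AlgOne R] projSum R (P.vertex (n + 1)),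
        (∀ v, P.d n (e' v) = 0 ↔ d n v = 0) ∧
        (∀ v ∈ projSumDegree R (vertex (n + 1)) 0, e' v ∈ projSumDegree R (P.vertex (n + 1)) 0) ∧
        ∀ v ∈ projSumDegree R (P.vertex (n + 1)) 0,
          e'.symm v ∈ projSumDegree R (vertex (n + 1)) 0 := by
    intro n e he
    obtain ⟨e', h1, h2, h3⟩ := exists_equiv (e.toLinearMap.comp (d n)) (P.d n) he
      (e.injective.comp_injOn (h.injOn n)) (hP.injOn n)
    refine ⟨e', fun v => ?_, h2, h3⟩
    rw [h1]
    exact e.map_eq_zero_iff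
  have main : ∀ n : ℕ,
      ∃ e' : projSum R (vertex (n + 1)) ≃ₗ[AlgOne R] projSum R (P.vertex (n + 1)),
        (∀ v, P.d n (e' v) = 0 ↔ d n v = 0) ∧
        (∀ v ∈ projSumDegree R (vertex (n + 1)) 0, e' v ∈ projSumDegree R (P.vertex (n + 1)) 0) ∧
        ∀ v ∈ projSumDegree R (P.vertex (n + 1)) 0,
          e'.symm v ∈ projSumDegree R (vertex (n + 1)) 0 := by
    intro n
    induction n with
    | zero =>
      exact next 0 e₀ (exact_of_degree_one_generated e₀ he₁ he₂ (fun v => by rw [he₀])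
        h.image_zero hP.image_zero).1
    | succ n ih =>
      obtain ⟨e, h1, h2, h3⟩ := ih
      exact next (n + 1) e (exact_of_degree_one_generated e h2 h3 h1
        (h.image_succ n) (hP.image_succ n)).1
  obtain ⟨e, h1, h2, h3⟩ := main n
  exact (exact_of_degree_one_generated e h2 h3 h1 (h.image_succ n) (hP.image_succ n)).2
    (P.exact_succ n)

end IsDiagonal

end BoundQuiver

/-! ## Coordinates on the local Koszul complex -/

namespace BoundQuiver

open PathAlgebra

variable {k : Type w} {Q : Type u} [Field k] [Quiver.{v} Q] {R : TwoSidedIdeal (PathAlgebra k Q)}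

/-- The map `Pₓ ⊗ W → Pₓ` given by a linear functional on `W`. -/
def tensorCoord (x : Q) {W : Type*} [AddCommGroup W] [Module k W] (l : W →ₗ[k] k) :
    proj R x ⊗[k] W →ₗ[AlgOne R] proj R x :=
  (TensorProduct.AlgebraTensorModule.rid k (AlgOne R) (proj R x)).toLinearMap.comp
    (TensorProduct.AlgebraTensorModule.map LinearMap.id l)

theorem tensorCoord_tmul (x : Q) {W : Type*} [AddCommGroup W] [Module k W] (l : W →ₗ[k] k)
    (u : proj R x) (r : W) : tensorCoord x l (u ⊗ₜ[k] r) = l r • u := by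
  simp [tensorCoord]

/-- A basis of W identifies Pₓ ⊗ W with finitely supported families in Pₓ. -/
theorem tensorCoord_ext {x : Q} {W ι : Type*} [AddCommGroup W] [Module k W]
    (b : Module.Basis ι k W) {s t : proj R x ⊗[k] W}
    (h : ∀ i, tensorCoord x (b.coord i) s = tensorCoord x (b.coord i) t) : s = t := by
  classical
  have h1 : ∀ (s : proj R x ⊗[k] W) (i : ι),
      TensorProduct.equivFinsuppOfBasisRight b s i = tensorCoord x (b.coord i) s := by
    intro s i
    induction s using TensorProduct.induction_on with
    | zero => simp
    | add s t hs ht => rw [map_add, map_add, Finsupp.add_apply, hs, ht]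
    | tmul u r =>
      rw [tensorCoord_tmul, TensorProduct.equivFinsuppOfBasisRight_apply_tmul_apply]
      rfl
  refine (TensorProduct.equivFinsuppOfBasisRight b).injective (Finsupp.ext fun i => ?_)
  rw [h1, h1, h]

variable {a : Q} {n : ℕ}

open Classical in
/-- The inclusion of the summand `Pₓ ⊗ R^{(n)}(a, x)` of `K_a⁻ⁿ`. -/
abbrev koszulIncl (R : TwoSidedIdeal (PathAlgebra k Q)) (a : Q) (n : ℕ) (x : Q) :
    proj R x ⊗[k] koszulPart R n a x →ₗ[AlgOne R] koszulTerm R a n :=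
  DirectSum.lof (AlgOne R) Q (fun x => proj R x ⊗[k] koszulPart R n a x) x

open Classical in
theorem koszul_ext {L : Type*} [AddCommMonoid L] [Module (AlgOne R) L]
    {f g : koszulTerm R a n →ₗ[AlgOne R] L}
    (h : ∀ (x : Q) (u : proj R x) (r : koszulPart R n a x),
      f (koszulIncl R a n x (u ⊗ₜ r)) = g (koszulIncl R a n x (u ⊗ₜ r))) : f = g := by
  refine DirectSum.linearMap_ext _ fun x => LinearMap.ext fun t => ?_
  induction t using TensorProduct.induction_on with
  | zero => simp
  | add s t hs ht => rw [map_add, map_add, hs, ht]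
  | tmul u r => exact h x u r

/-- The map `K_a⁻ⁿ → Pₓ` given by a linear functional on `R^{(n)}(a, x)`. -/
def koszulCoord {x : Q} (l : koszulPart R n a x →ₗ[k] k) :
    koszulTerm R a n →ₗ[AlgOne R] proj R x :=
  (tensorCoord x l).comp
    (DirectSum.component (AlgOne R) Q (fun x => proj R x ⊗[k] koszulPart R n a x) x)

theorem koszulCoord_incl_self {x : Q} (l : koszulPart R n a x →ₗ[k] k) (u : proj R x)
    (r : koszulPart R n a x) : koszulCoord l (koszulIncl R a n x (u ⊗ₜ r)) = l r • u := by
  rw [koszulCoord, LinearMap.comp_apply, koszulIncl, DirectSum.component.lof_self, tensorCoord_tmul]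

theorem koszulCoord_incl_of_ne {x y : Q} (h : y ≠ x) (l : koszulPart R n a x →ₗ[k] k)
    (t : proj R y ⊗[k] koszulPart R n a y) : koszulCoord l (koszulIncl R a n y t) = 0 := by
  rw [koszulCoord, LinearMap.comp_apply, koszulIncl, DirectSum.component.of, dif_neg h, map_zero]

theorem coe_smul_proj {x : Q} (c : k) (u : proj R x) : ((c • u : proj R x) : AlgOne R) = c • u :=
  rfl

theorem koszulCoord_incl_mem {x y : Q} (l : koszulPart R n a x →ₗ[k] k) {i : ℕ} {u : proj R y}
    (hu : (u : AlgOne R) ∈ gradedPart R i) (r : koszulPart R n a y) :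
    (koszulCoord l (koszulIncl R a n y (u ⊗ₜ r)) : AlgOne R) ∈ gradedPart R i := by
  by_cases h : y = x
  · subst h
    rw [koszulCoord_incl_self, coe_smul_proj]
    exact Submodule.smul_mem _ _ hu
  · rw [koszulCoord_incl_of_ne h]
    exact zero_mem _

/-- The coefficient of a path `p : a ⟶ x` in the second factor, `u ⊗ γ ↦ γ_p u`. -/
def koszulCoeff {x : Q} (p : Quiver.Path a x) : koszulTerm R a n →ₗ[AlgOne R] proj R x :=
  koszulCoord ((pathCoeff ⟨a, x, p⟩).comp (koszulPart R n a x).subtype)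

theorem coe_koszulCoeff_incl {x y : Q} (p : Quiver.Path a x) (u : proj R y)
    (r : koszulPart R n a y) : (koszulCoeff p (koszulIncl R a n y (u ⊗ₜ r)) : AlgOne R) =
      pathCoeff ⟨a, x, p⟩ (r : PathAlgebra k Q) • (u : AlgOne R) := by
  by_cases h : y = x
  · subst h
    rw [koszulCoeff, koszulCoord_incl_self, coe_smul_proj]
    rfl
  · rw [koszulCoeff, koszulCoord_incl_of_ne h,
      pathCoeff_of_mem_homPart (koszulPart_le R n a y r.2), zero_smul]
    · rfl
    · rintro ⟨-, h', -⟩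
      exact h h'.symm

-- Over a field, tensoring the inclusion of R^{(n)}(a, x) into kQ stays injective, so path
-- coefficients separate elements although paths need not lie in R^{(n)}(a, x). This lets the
-- differential be computed without a basis of R^{(n)}(a, x).
open Classical in
theorem koszulCoeff_ext {s t : koszulTerm R a n}
    (h : ∀ (x : Q) (p : Quiver.Path a x), p.length = n → koszulCoeff p s = koszulCoeff p t) :
    s = t := by
  refine DirectSum.ext_component (AlgOne R) fun x => ?_
  have hinj : Function.Injective (LinearMap.lTensor (proj R x) (koszulPart R n a x).subtype) :=
    Module.Flat.lTensor_preserves_injective_linearMap _ (Submodule.injective_subtype _)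
  refine hinj ?_
  refine tensorCoord_ext pathBasis fun p => ?_
  have h1 : ∀ s : proj R x ⊗[k] koszulPart R n a x, tensorCoord x (pathBasis.coord p)
      (LinearMap.lTensor (proj R x) (koszulPart R n a x).subtype s) =
        tensorCoord x ((pathCoeff p).comp (koszulPart R n a x).subtype) s := by
    intro s
    induction s using TensorProduct.induction_on with
    | zero => simp
    | add s t hs ht => simp only [map_add, hs, ht]
    | tmul u r => rw [LinearMap.lTensor_tmul, tensorCoord_tmul, tensorCoord_tmul]; rfl
  rw [h1, h1]
  by_cases hp : p.1 = a ∧ p.2.1 = x ∧ p.2.2.length = n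
  · obtain ⟨a', x', p⟩ := p
    obtain ⟨rfl, rfl, hp⟩ := hp
    exact h _ p hp
  · have h2 : (pathCoeff p).comp (koszulPart R n a x).subtype = 0 :=
      LinearMap.ext fun r => pathCoeff_of_mem_homPart (koszulPart_le R n a x r.2) p hp
    have h3 : tensorCoord (R := R) x ((pathCoeff p).comp (koszulPart R n a x).subtype) = 0 := by
      rw [h2]
      refine TensorProduct.AlgebraTensorModule.ext fun u r => ?_
      rw [tensorCoord_tmul]
      exact Subtype.ext (zero_smul k (u : AlgOne R))
    rw [h3, LinearMap.zero_apply, LinearMap.zero_apply]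

/-! ### The Koszul terms as finite direct sums of the Pₓ -/

section LocallyFinite

variable [Quiver.IsLocallyFinite Q]

instance (R : TwoSidedIdeal (PathAlgebra k Q)) (n : ℕ) (a x : Q) :
    Module.Finite k (koszulPart R n a x) :=
  Module.Finite.of_injective _ (Submodule.inclusion_injective (koszulPart_le R n a x))

/-- The index set of a basis of `⨁ₓ R^{(n)}(a, x)`. -/
abbrev KoszulIndex (R : TwoSidedIdeal (PathAlgebra k Q)) (a : Q) (n : ℕ) : Type u :=
  Σ x : Q, Fin (Module.finrank k (koszulPart R n a x))

theorem eq_zero_of_notMem_image {x : Q}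
    (hx : x ∉ (fun p => p.1) '' (pathsFrom a n : Set (Σ y : Q, Quiver.Path a y)))
    (r : koszulPart R n a x) : r = 0 := by
  by_contra h
  obtain ⟨p, hp⟩ := exists_path_of_mem_homPart (koszulPart_le R n a x r.2)
    fun h' => h (Subtype.ext h')
  exact hx ⟨⟨x, p⟩, mem_pathsFrom.2 hp, rfl⟩

/-- Only the finitely many ends of paths of length n from a can carry a nonzero R^{(n)}(a, x), and
each such space is finite-dimensional. -/
instance : Finite (KoszulIndex R a n) := by
  let S := (fun p => p.1) '' (pathsFrom a n : Set (Σ y : Q, Quiver.Path a y))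
  have hS : S.Finite := (pathsFrom a n).finite_toSet.image _
  have := hS.to_subtype
  refine Finite.of_surjective
    (fun i : Σ x : S, Fin (Module.finrank k (koszulPart R n a x.1)) =>
      (⟨i.1.1, i.2⟩ : KoszulIndex R a n)) ?_
  rintro ⟨x, l⟩
  by_cases hx : x ∈ S
  · exact ⟨⟨⟨x, hx⟩, l⟩, rfl⟩
  · have : Subsingleton (koszulPart R n a x) :=
      ⟨fun r s => (eq_zero_of_notMem_image hx r).trans (eq_zero_of_notMem_image hx s).symm⟩
    rw [Module.finrank_zero_of_subsingleton] at l
    exact l.elim0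

/-- The number of summands of `K_a⁻ⁿ`. -/
def koszulRank (R : TwoSidedIdeal (PathAlgebra k Q)) (a : Q) (n : ℕ) : ℕ :=
  Nat.card (KoszulIndex R a n)

/-- An enumeration of the summands of `K_a⁻ⁿ`. -/
def koszulEnum (R : TwoSidedIdeal (PathAlgebra k Q)) (a : Q) (n : ℕ) :
    Fin (koszulRank R a n) ≃ KoszulIndex R a n :=
  (Finite.equivFin _).symm

/-- The vertices of the summands of `K_a⁻ⁿ`. -/
def koszulVertex (R : TwoSidedIdeal (PathAlgebra k Q)) (a : Q) (n : ℕ)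
    (i : Fin (koszulRank R a n)) : Q :=
  (koszulEnum R a n i).1

/-- A basis of `R^{(n)}(a, x)`. -/
abbrev koszulBasis (R : TwoSidedIdeal (PathAlgebra k Q)) (a : Q) (n : ℕ) (x : Q) :
    Module.Basis (Fin (Module.finrank k (koszulPart R n a x))) k (koszulPart R n a x) :=
  Module.finBasis k _

/-- The map from `K_a⁻ⁿ` to a finite direct sum of the `Pₓ`. -/
def koszulToSum (R : TwoSidedIdeal (PathAlgebra k Q)) (a : Q) (n : ℕ) :
    koszulTerm R a n →ₗ[AlgOne R] projSum R (koszulVertex R a n) :=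
  LinearMap.pi fun i =>
    koszulCoord ((koszulBasis R a n (koszulEnum R a n i).1).coord (koszulEnum R a n i).2)

theorem koszulToSum_injective : Function.Injective (koszulToSum R a n) := by
  intro s t hst
  have h : ∀ i : KoszulIndex R a n, koszulCoord ((koszulBasis R a n i.1).coord i.2) s =
      koszulCoord ((koszulBasis R a n i.1).coord i.2) t := by
    intro i
    obtain ⟨i, rfl⟩ := (koszulEnum R a n).surjective i
    exact congrFun hst i
  refine DirectSum.ext_component (AlgOne R) fun x => ?_
  exact tensorCoord_ext (koszulBasis R a n x) fun l => h ⟨x, l⟩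

theorem koszulCoord_basis_self (i : KoszulIndex R a n) (u : proj R i.1) :
    koszulCoord ((koszulBasis R a n i.1).coord i.2)
      (koszulIncl R a n i.1 (u ⊗ₜ koszulBasis R a n i.1 i.2)) = u := by
  rw [koszulCoord_incl_self, Module.Basis.coord_apply, Module.Basis.repr_self,
      Finsupp.single_eq_same]
  exact Subtype.ext (one_smul k (u : AlgOne R))

theorem koszulCoord_basis_of_ne {i j : KoszulIndex R a n} (h : i ≠ j) (u : proj R i.1) :
    koszulCoord ((koszulBasis R a n j.1).coord j.2)
      (koszulIncl R a n i.1 (u ⊗ₜ koszulBasis R a n i.1 i.2)) = 0 := by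
  obtain ⟨x, i⟩ := i
  obtain ⟨y, j⟩ := j
  by_cases hxy : x = y
  · subst hxy
    have hij : i ≠ j := fun h' => h (by rw [h'])
    rw [koszulCoord_incl_self, Module.Basis.coord_apply, Module.Basis.repr_self,
      Finsupp.single_eq_of_ne hij.symm]
    exact Subtype.ext (zero_smul k (u : AlgOne R))
  · rw [koszulCoord_incl_of_ne hxy]

theorem koszulToSum_sum (v : projSum R (koszulVertex R a n)) :
    koszulToSum R a n (∑ i, koszulIncl R a n (koszulEnum R a n i).1
      (v i ⊗ₜ koszulBasis R a n (koszulEnum R a n i).1 (koszulEnum R a n i).2)) = v := by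
  funext j
  rw [koszulToSum, LinearMap.pi_apply, map_sum, Finset.sum_eq_single j]
  · exact koszulCoord_basis_self _ _
  · intro i _ hij
    exact koszulCoord_basis_of_ne (fun h => hij ((koszulEnum R a n).injective h)) _
  · intro h
    exact absurd (Finset.mem_univ _) h

/-- `K_a⁻ⁿ` is a finite direct sum of the modules `Pₓ`. -/
def koszulEquiv (R : TwoSidedIdeal (PathAlgebra k Q)) (a : Q) (n : ℕ) :
    koszulTerm R a n ≃ₗ[AlgOne R] projSum R (koszulVertex R a n) :=
  LinearEquiv.ofBijective (koszulToSum R a n)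
    ⟨koszulToSum_injective, fun v => ⟨_, koszulToSum_sum v⟩⟩

theorem koszulEquiv_symm_apply (v : projSum R (koszulVertex R a n)) :
    (koszulEquiv R a n).symm v = ∑ i, koszulIncl R a n (koszulEnum R a n i).1
      (v i ⊗ₜ koszulBasis R a n (koszulEnum R a n i).1 (koszulEnum R a n i).2) :=
  (LinearEquiv.symm_apply_eq _).2 (koszulToSum_sum v).symm

theorem koszulEquiv_incl_mem {x : Q} {i : ℕ} {u : proj R x}
    (hu : (u : AlgOne R) ∈ gradedPart R i) (r : koszulPart R n a x) :
    koszulEquiv R a n (koszulIncl R a n x (u ⊗ₜ r)) ∈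
      projSumDegree R (koszulVertex R a n) i :=
  fun _ => koszulCoord_incl_mem _ hu r

theorem koszulCoeff_mem {i : ℕ} {t : koszulTerm R a n}
    (ht : koszulEquiv R a n t ∈ projSumDegree R (koszulVertex R a n) i) {x : Q}
    (p : Quiver.Path a x) : (koszulCoeff p t : AlgOne R) ∈ gradedPart R i := by
  rw [← (koszulEquiv R a n).symm_apply_apply t, koszulEquiv_symm_apply, map_sum,
    AddSubmonoidClass.coe_finsetSum]
  exact sum_mem fun j _ => koszulCoord_incl_mem _ (ht j) _

instance (n : ℕ) : Module.Projective (AlgOne R) (koszulTerm R a n) :=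
  have : Module.Projective (AlgOne R) (projSum R (koszulVertex R a n)) :=
    Module.Projective.of_equiv (DFinsupp.linearEquivFunOnFintype (R := AlgOne R)
      (M := fun i => proj R (koszulVertex R a n i)))
  Module.Projective.of_equiv (koszulEquiv R a n).symm

/-- The element `∑ₓ eₓ ⊗ γₓ` of `K_a⁻ⁿ`. -/
theorem exists_koszul_degree_zero (γ : ∀ x, koszulPart R n a x) :
    ∃ t : koszulTerm R a n, koszulEquiv R a n t ∈ projSumDegree R (koszulVertex R a n) 0 ∧
      ∀ (x : Q) (p : Quiver.Path a x), (koszulCoeff p t : AlgOne R) =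
        pathCoeff ⟨a, x, p⟩ (γ x : PathAlgebra k Q) • idem R x := by
  classical
  refine ⟨∑ z ∈ (pathsFrom a n).image (fun p => p.1), koszulIncl R a n z (projGen R z ⊗ₜ γ z),
    ?_, fun x p => ?_⟩
  · rw [map_sum]
    exact sum_mem_projSumDegree _ fun z _ => koszulEquiv_incl_mem (idem_mem_gradedPart R z) _
  · rw [map_sum, AddSubmonoidClass.coe_finsetSum, Finset.sum_eq_single x]
    · exact coe_koszulCoeff_incl p _ _
    · intro z _ hz
      rw [koszulCoeff, koszulCoord_incl_of_ne hz]
      rfl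
    · intro hx
      rw [coe_koszulCoeff_incl, eq_zero_of_notMem_image (a := a) (n := n) (x := x) ?_ (γ x)]
      · simp
      · rwa [← Finset.coe_image, Finset.mem_coe]

/-! ### The Koszul differential and augmentation in path coefficients -/

theorem koszulD_incl {x : Q} (u : proj R x) (r : koszulPart R (n + 1) a x) :
    koszulD R a n (koszulIncl R a (n + 1) x (u ⊗ₜ r)) = ∑ α : Quiver.Costar x,
      koszulIncl R a n α.1 (projMap R α.2 u ⊗ₜ stripKoszul R a n α.2 r) := by
  rw [koszulD, koszulIncl, DirectSum.toModule_lof, LinearMap.sum_apply]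
  rfl

/-- The differential in terms of coefficients. -/
theorem coe_koszulCoeff_koszulD {y : Q} (δ : Quiver.Path a y) (t : koszulTerm R a (n + 1)) :
    (koszulCoeff δ (koszulD R a n t) : AlgOne R) =
      ∑ α : Quiver.Star y, (koszulCoeff (δ.cons α.2) t : AlgOne R) * arrow R α.2 := by
  have h : (koszulCoeff δ).comp (koszulD R a n) =
      ∑ α : Quiver.Star y, (projMap R α.2).comp (koszulCoeff (δ.cons α.2)) := by
    refine koszul_ext fun x u r => Subtype.ext ?_
    rw [LinearMap.comp_apply, koszulD_incl, map_sum, AddSubmonoidClass.coe_finsetSum, LinearMap.sum_apply,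
      AddSubmonoidClass.coe_finsetSum]
    have h2 : ∀ α : Quiver.Costar x,
        (koszulCoeff δ (koszulIncl R a n α.1 (projMap R α.2 u ⊗ₜ stripKoszul R a n α.2 r)) :
          AlgOne R) = pathCoeff ⟨a, y, δ⟩ (strip α.2 (r : PathAlgebra k Q)) •
            ((u : AlgOne R) * arrow R α.2) := fun α => coe_koszulCoeff_incl _ _ _
    have h3 : ∀ α : Quiver.Star y, (((projMap R α.2).comp (koszulCoeff (δ.cons α.2)))
        (koszulIncl R a (n + 1) x (u ⊗ₜ r)) : AlgOne R) =
          pathCoeff ⟨a, α.1, δ.cons α.2⟩ (r : PathAlgebra k Q) •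
            ((u : AlgOne R) * arrow R α.2) := fun α => by
      rw [← smul_mul_assoc, ← coe_koszulCoeff_incl (δ.cons α.2) u r]
      rfl
    simp only [h2, h3]
    -- One sum runs over all arrows into x, the other over all arrows out of y. In both, only arrows
    -- from y to x contribute, because the other coefficients sit at paths with a wrong endpoint.
    have hfin : Finite (y ⟶ x) := Finite.of_injective (fun f => (⟨x, f⟩ : Quiver.Star y))
      fun f g hfg => by cases hfg; rfl
    let _ := Fintype.ofFinite (y ⟶ x)
    have h4 := Fintype.sum_of_injective (fun f : y ⟶ x => (⟨y, f⟩ : Quiver.Costar x))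
      (fun f g hfg => by cases hfg; rfl)
      (fun f => pathCoeff ⟨a, x, δ.cons f⟩ (r : PathAlgebra k Q) • ((u : AlgOne R) * arrow R f))
      (fun α => pathCoeff ⟨a, y, δ⟩ (strip α.2 (r : PathAlgebra k Q)) •
            ((u : AlgOne R) * arrow R α.2)) ?_ (fun f => by rw [pathCoeff_strip])
    have h5 := Fintype.sum_of_injective (fun f : y ⟶ x => (⟨x, f⟩ : Quiver.Star y))
      (fun f g hfg => by cases hfg; rfl)
      (fun f => pathCoeff ⟨a, x, δ.cons f⟩ (r : PathAlgebra k Q) • ((u : AlgOne R) * arrow R f))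
      (fun α => pathCoeff ⟨a, α.1, δ.cons α.2⟩ (r : PathAlgebra k Q) •
            ((u : AlgOne R) * arrow R α.2)) ?_ (fun f => rfl)
    · exact h4.symm.trans h5
    · rintro ⟨x', f⟩ hf
      rw [pathCoeff_of_mem_homPart (koszulPart_le R _ a x r.2), zero_smul]
      rintro ⟨-, h', -⟩
      cases h'
      exact hf ⟨f, rfl⟩
    · rintro ⟨y', f⟩ hf
      rw [pathCoeff_of_mem_homPart (strip_mem_homPart f (koszulPart_le R _ a x r.2)), zero_smul]
      rintro ⟨-, h', -⟩
      cases h'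
      exact hf ⟨f, rfl⟩
  have h' := congrArg (fun f => (f t : AlgOne R)) h
  rw [LinearMap.sum_apply, AddSubmonoidClass.coe_finsetSum] at h'
  exact h'

end LocallyFinite

/-- The augmentation in terms of coefficients. -/
theorem koszulAug_apply (t : koszulTerm R a 0) :
    koszulAug R a t = (radMul R (proj R a)).mkQ (koszulCoeff Quiver.Path.nil t) := by
  classical
  have h : koszulAug R a = (radMul R (proj R a)).mkQ.comp (koszulCoeff Quiver.Path.nil) := by
    refine koszul_ext fun x u r => ?_
    rw [koszulAug, LinearMap.comp_apply, LinearMap.comp_apply, koszulIncl, DirectSum.toModule_lof]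
    congr 1
    refine Subtype.ext ?_
    rw [← koszulIncl, coe_koszulCoeff_incl]
    change (u : AlgOne R) * bar R r = _
    have hr : (r : PathAlgebra k Q) ∈ homPart k 0 a x := koszulPart_le R 0 a x r.2
    by_cases hx : x = a
    · subst hx
      have h1 : ∀ f ∈ homPart k 0 x x, f =
          pathCoeff ⟨x, x, Quiver.Path.nil⟩ f • ofPath (Quiver.Path.nil : Quiver.Path x x) := by
        intro f hf
        induction hf using Submodule.span_induction with
        | zero => simp
        | add f g _ _ hf hg => rw [map_add, add_smul, ← hf, ← hg]
        | smul c f _ hf => rw [map_smul, smul_assoc, ← hf]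
        | mem f hf =>
          obtain ⟨p, hp, rfl⟩ := hf
          cases p with
          | nil => rw [pathCoeff_ofPath_self, one_smul]
          | cons p α => simp at hp
      conv_lhs => rw [h1 _ hr, map_smul, mul_smul_comm]
      congr 1
      exact mul_idem_of_mem_proj R u.2
    · have h1 : (r : PathAlgebra k Q) = 0 := by
        by_contra h0
        obtain ⟨p, hp⟩ := exists_path_of_mem_homPart hr h0
        cases p with
        | nil => exact hx rfl
        | cons p α => simp at hp
      rw [h1]
      simp
  rw [h]
  rfl

end BoundQuiver

/-! ## The local Koszul complex is diagonal -/

namespace PathAlgebra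

variable {k : Type w} {Q : Type u} [Field k] [Quiver.{v} Q] {R : TwoSidedIdeal (PathAlgebra k Q)}

theorem pathCoeff_mul_vertex_of_ne (f : PathAlgebra k Q) {x : Q} {p : QPath Q} (h : p.1 ≠ x) :
    pathCoeff p (f * ofPath (Quiver.Path.nil : Quiver.Path x x)) = 0 := by
  induction f using induction_path with
  | h0 => simp
  | hadd f g hf hg => rw [add_mul, map_add, hf, hg, add_zero]
  | hpath c s t q =>
    rw [smul_mul_assoc, map_smul]
    by_cases hx : x = s
    · subst hx
      rw [ofPath_mul_ofPath, Quiver.Path.nil_comp, pathCoeff_ofPath_of_ne, smul_zero]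
      rintro rfl
      exact h rfl
    · rw [ofPath_mul_ofPath_of_ne _ _ hx, map_zero, smul_zero]

theorem mul_mem_sandwich {i j : ℕ} {a y z : Q} {ζ f : PathAlgebra k Q} (hζ : ζ ∈ homPart k 1 y z)
    (hf : f ∈ sandwich R i j a y) : ζ * f ∈ sandwich R (i + 1) j a z := by
  induction hf using Submodule.span_induction with
  | zero => simp
  | add f g _ _ hf hg => rw [mul_add]; exact add_mem hf hg
  | smul c f _ hf => rw [mul_smul_comm]; exact Submodule.smul_mem _ _ hf
  | mem f hf =>
    obtain ⟨b, c, ξ, hξ, ρ, hρ, δ, hδ, rfl⟩ := hf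
    refine Submodule.subset_span ⟨b, c, ζ * ξ, ?_, ρ, hρ, δ, hδ, by simp only [mul_assoc]⟩
    rw [add_comm]
    exact mul_mem_homPart hζ hξ

/-- Deleting α undoes the assembly of ∑ β g_β from its parts; this is why the assembled element maps
back to the given cycle. -/
theorem strip_sum_arrow_mul [Quiver.IsLocallyFinite Q] {n : ℕ} {a y z : Q} (α : y ⟶ z)
    {g : Quiver.Costar z → PathAlgebra k Q} (hg : ∀ β, g β ∈ homPart k n a β.1) :
    strip α (∑ β : Quiver.Costar z, ofPath β.2.toPath * g β) = g ⟨y, α⟩ := by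
  have h : ∀ β : Quiver.Costar z, strip α (ofPath β.2.toPath * g β) =
      strip α (ofPath β.2.toPath) * g β :=
    fun β => strip_mul α (n := 0) (BoundQuiver.arrow_mem_homPart β.2) _
  rw [map_sum, Finset.sum_eq_single (⟨y, α⟩ : Quiver.Costar z)]
  · rw [h]
    have h1 : strip α (ofPath α.toPath : PathAlgebra k Q) = ofPath Quiver.Path.nil :=
      strip_ofPath_cons α Quiver.Path.nil
    rw [h1, vertex_mul_of_mem_homPart (hg ⟨y, α⟩)]
  · rintro ⟨y', β⟩ - hβ
    rw [h]
    have h1 : strip α (ofPath β.toPath : PathAlgebra k Q) = 0 :=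
      strip_ofPath_cons_of_ne α Quiver.Path.nil β fun h' => hβ (by cases h'; rfl)
    rw [h1, zero_mul]
  · intro h
    exact absurd (Finset.mem_univ _) h

theorem arrow_mul_arrow_mem_homPart {y y' x z : Q} (α : y ⟶ z) (β : x ⟶ y') :
    (ofPath α.toPath * ofPath β.toPath : PathAlgebra k Q) ∈ homPart k 2 x z := by
  by_cases h : y' = y
  · subst h
    have h := mul_mem_homPart (k := k) (BoundQuiver.arrow_mem_homPart α)
      (BoundQuiver.arrow_mem_homPart β)
    exact h
  · rw [ofPath_mul_ofPath_of_ne _ _ h]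
    exact zero_mem _

end PathAlgebra

namespace BoundQuiver

open PathAlgebra

variable {k : Type w} {Q : Type u} [Field k] [Quiver.{v} Q] {R : TwoSidedIdeal (PathAlgebra k Q)}

/-! ### Arrow coefficients in Λ -/

/-- The coefficient of an arrow in an element of `Λ`. It is well-defined since quadratic ideals
contain no arrows. -/
def arrowCoeffAlg (hR : IsQuadratic R) {x y : Q} (α : x ⟶ y) : Alg R →ₗ[k] k where
  toFun u := Quotient.liftOn' u (fun f => pathCoeff ⟨x, y, α.toPath⟩ f) fun f g h => by
    have h' : f - g ∈ R := (TwoSidedIdeal.rel_iff R f g).1 h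
    rw [← sub_eq_zero, ← map_sub]
    exact pathCoeff_of_mem_geDegree (hR.mem_geDegree h') _ Nat.one_lt_two
  map_add' u v := by
    obtain ⟨f, rfl⟩ := toAlg_surjective R u
    obtain ⟨g, rfl⟩ := toAlg_surjective R v
    exact map_add (pathCoeff ⟨x, y, α.toPath⟩) f g
  map_smul' c u := by
    obtain ⟨f, rfl⟩ := toAlg_surjective R u
    exact map_smul (pathCoeff ⟨x, y, α.toPath⟩) c f

/-- The coefficient of an arrow, extended by zero to the algebra with adjoined identity. -/
def arrowCoeff (hR : IsQuadratic R) {x y : Q} (α : x ⟶ y) : AlgOne R →ₗ[k] k :=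
  (arrowCoeffAlg hR α).comp (Unitization.sndHom k k (Alg R))

theorem arrowCoeff_bar (hR : IsQuadratic R) {x y : Q} (α : x ⟶ y) (f : PathAlgebra k Q) :
    arrowCoeff hR α (bar R f) = pathCoeff ⟨x, y, α.toPath⟩ f :=
  rfl

theorem arrowCoeff_of_mem_proj_of_ne (hR : IsQuadratic R) {x y z : Q} (α : x ⟶ y) (h : x ≠ z)
    (u : proj R z) : arrowCoeff hR α u = 0 := by
  obtain ⟨f, -, hf⟩ := proj_le_gePart R u.2
  rw [← mul_idem_of_mem_proj R u.2, ← hf, idem, ← bar_mul, arrowCoeff_bar]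
  exact pathCoeff_mul_vertex_of_ne f h

theorem idem_mul_arrow {x y : Q} (α : x ⟶ y) : idem R y * arrow R α = arrow R α := by
  rw [idem, arrow, ← bar_mul, ofPath_mul_ofPath, Quiver.Path.comp_nil]

variable {a : Q} {n : ℕ}

/-- The terminal arrow `α` of the first factor, `u ⊗ γ ↦ u_α γ`, in terms of coefficients. -/
theorem exists_arrow_part (hR : IsQuadratic R) (t : koszulTerm R a n) {y z : Q} (α : y ⟶ z) :
    ∃ g : koszulPart R n a y, ∀ (x : Q) (p : Quiver.Path a x),
      pathCoeff ⟨a, x, p⟩ (g : PathAlgebra k Q) = arrowCoeff hR α (koszulCoeff p t) := by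
  have key : ∀ τ : proj R y ⊗[k] koszulPart R n a y, ∃ g : koszulPart R n a y, ∀ p : QPath Q,
      pathCoeff p (g : PathAlgebra k Q) = arrowCoeff hR α
        (tensorCoord y ((pathCoeff p).comp (koszulPart R n a y).subtype) τ) := by
    intro τ
    induction τ using TensorProduct.induction_on with
    | zero => exact ⟨0, fun p => by simp⟩
    | add s t hs ht =>
      obtain ⟨g, hg⟩ := hs
      obtain ⟨h, hh⟩ := ht
      refine ⟨g + h, fun p => ?_⟩
      rw [map_add, Submodule.coe_add, Submodule.coe_add, map_add, map_add, hg, hh]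
    | tmul u r =>
      -- The functional u ↦ u_α is applied to the first tensor factor, which keeps the result in
      -- R^{(n)}(a, y).
      refine ⟨arrowCoeff hR α u • r, fun p => ?_⟩
      rw [tensorCoord_tmul, coe_smul_proj, Submodule.coe_smul, map_smul, map_smul, smul_eq_mul,
        smul_eq_mul, mul_comm]
      rfl
  obtain ⟨g, hg⟩ := key (DirectSum.component (AlgOne R) Q
    (fun x => proj R x ⊗[k] koszulPart R n a x) y t)
  refine ⟨g, fun x p => ?_⟩
  by_cases hx : y = x
  · subst hx
    exact hg ⟨a, y, p⟩
  · rw [arrowCoeff_of_mem_proj_of_ne hR α hx,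
      pathCoeff_of_mem_homPart (koszulPart_le R n a y g.2)]
    rintro ⟨-, h, -⟩
    exact hx h.symm

theorem koszulAug_surjective : Function.Surjective (koszulAug R a) := by
  intro v
  obtain ⟨u, rfl⟩ := Submodule.mkQ_surjective _ v
  refine ⟨koszulIncl R a 0 a (u ⊗ₜ ⟨ofPath Quiver.Path.nil,
    ofPath_mem_homPart (Quiver.Path.nil : Quiver.Path a a)⟩), ?_⟩
  rw [koszulAug_apply]
  congr 1
  refine Subtype.ext ?_
  rw [coe_koszulCoeff_incl, pathCoeff_ofPath_self, one_smul]

variable [Quiver.IsLocallyFinite Q]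

theorem eq_sum_arrowCoeff (hR : IsQuadratic R) {y : Q} {u : proj R y}
    (hu : (u : AlgOne R) ∈ gradedPart R 1) :
    (u : AlgOne R) = ∑ α : Quiver.Star y, arrowCoeff hR α.2 u • arrow R α.2 := by
  obtain ⟨f, hf, hfu⟩ := hu
  have h1 : (u : AlgOne R) = bar R (f * ofPath (Quiver.Path.nil : Quiver.Path y y)) := by
    rw [bar_mul, hfu]
    exact (mul_idem_of_mem_proj R u.2).symm
  conv_lhs => rw [h1, mul_vertex_eq_sum hf, map_sum]
  refine Finset.sum_congr rfl fun α _ => ?_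
  rw [map_smul, ← arrowCoeff_bar hR, hfu]
  rfl

/-- This lifts e_z u to a combination of arrows in kQ, so that equations in Λ become membership in
R. -/
theorem bar_sum_arrowCoeff (hR : IsQuadratic R) (z : Q) {u : AlgOne R}
    (hu : u ∈ gradedPart R 1) :
    bar R (∑ α : Quiver.Costar z, arrowCoeff hR α.2 u • ofPath α.2.toPath) = idem R z * u := by
  obtain ⟨f, hf, rfl⟩ := hu
  simp only [arrowCoeff_bar]
  rw [← vertex_mul_eq_sum hf, bar_mul, idem]

/-! ### Cycles of degree one are images of elements of degree zero -/

/-- Multiplying the coefficients of a cycle of degree one by their arrows gives elements of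
`R^{(n+1)}`. -/
theorem sum_arrow_mul_mem_koszulPart (hR : IsQuadratic R) {t : koszulTerm R a n}
    (ht : koszulEquiv R a n t ∈ projSumDegree R (koszulVertex R a n) 1)
    (hd : ∀ m, ∀ h : n = m + 1, koszulD R a m (h ▸ t) = 0) (z : Q)
    (g : ∀ β : Quiver.Costar z, koszulPart R n a β.1)
    (hg : ∀ (β : Quiver.Costar z) (x : Q) (p : Quiver.Path a x),
      pathCoeff ⟨a, x, p⟩ (g β : PathAlgebra k Q) = arrowCoeff hR β.2 (koszulCoeff p t)) :
    ∑ β : Quiver.Costar z, ofPath β.2.toPath * (g β : PathAlgebra k Q) ∈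
      koszulPart R (n + 1) a z := by
  have hhom : ∑ β : Quiver.Costar z, ofPath β.2.toPath * (g β : PathAlgebra k Q) ∈
      homPart k (n + 1) a z := by
    refine sum_mem fun β _ => ?_
    rw [add_comm]
    exact mul_mem_homPart (arrow_mem_homPart β.2) (koszulPart_le R n a _ (g β).2)
  match n with
  | 0 => exact hhom
  | m + 1 =>
    have hd' : koszulD R a m t = 0 := hd m rfl
    -- The element ∑ β g_β is regrouped by the initial subpath δ of length m; `ρ δ` collects the two
    -- arrows that follow it.
    let ρ : (Σ y : Q, Quiver.Path a y) → PathAlgebra k Q := fun δ =>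
      ∑ β : Quiver.Star δ.1, (∑ α : Quiver.Costar z,
        arrowCoeff hR α.2 (koszulCoeff (δ.2.cons β.2) t) • ofPath α.2.toPath) * ofPath β.2.toPath
    -- The class of `ρ δ` is e_z times the coefficient at δ of the differential of t, which is zero.
    have hρR : ∀ δ, ρ δ ∈ R := by
      intro δ
      rw [← bar_eq_zero, map_sum]
      have h1 : ∀ β : Quiver.Star δ.1, bar R ((∑ α : Quiver.Costar z,
          arrowCoeff hR α.2 (koszulCoeff (δ.2.cons β.2) t) • ofPath α.2.toPath) *
            ofPath β.2.toPath) =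
          idem R z * ((koszulCoeff (δ.2.cons β.2) t : AlgOne R) * arrow R β.2) := by
        intro β
        rw [bar_mul, bar_sum_arrowCoeff hR z (koszulCoeff_mem ht _), mul_assoc]
        rfl
      rw [Finset.sum_congr rfl fun β _ => h1 β, ← Finset.mul_sum, ← coe_koszulCoeff_koszulD, hd',
        map_zero]
      exact mul_zero _
    have hρ : ∀ δ, ρ δ ∈ homPart k 2 δ.1 z := by
      intro δ
      refine sum_mem fun β _ => ?_
      rw [Finset.sum_mul]
      refine sum_mem fun α _ => ?_
      rw [smul_mul_assoc]
      exact Submodule.smul_mem _ _ (arrow_mul_arrow_mem_homPart _ _)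
    have hsum : ∑ β : Quiver.Costar z, ofPath β.2.toPath * (g β : PathAlgebra k Q) =
        ∑ δ ∈ pathsFrom a m, ρ δ * ofPath δ.2 := by
      have h1 : ∀ α : Quiver.Costar z, ofPath α.2.toPath * (g α : PathAlgebra k Q) =
          ∑ δ ∈ pathsFrom a m, ∑ β : Quiver.Star δ.1,
            arrowCoeff hR α.2 (koszulCoeff (δ.2.cons β.2) t) •
              (ofPath α.2.toPath * (ofPath β.2.toPath * ofPath δ.2)) := by
        intro α
        conv_lhs => rw [eq_sum_pathCoeff_cons (koszulPart_le R (m + 1) a _ (g α).2)]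
        simp only [Finset.mul_sum, mul_smul_comm, hg]
      rw [Finset.sum_congr rfl fun α _ => h1 α, Finset.sum_comm]
      refine Finset.sum_congr rfl fun δ _ => ?_
      rw [Finset.sum_comm]
      simp only [ρ, Finset.sum_mul, smul_mul_assoc, mul_assoc]
    have key : ∀ j ≤ m, ∑ β : Quiver.Costar z, ofPath β.2.toPath * (g β : PathAlgebra k Q) ∈
        sandwich R (m - j) j a z := by
      intro j hj
      -- For j = m the regrouped form ∑ ρ_δ δ is the required one; for j < m the condition is
      -- inherited from the g_β by prefixing an arrow.
      rcases hj.eq_or_lt with rfl | hj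
      · rw [hsum, Nat.sub_self]
        refine sum_mem fun δ hδ => ?_
        have hz : (ofPath (Quiver.Path.nil : Quiver.Path z z) : PathAlgebra k Q) ∈
          homPart k 0 z z := Submodule.subset_span ⟨_, rfl, rfl⟩
        have hδ' : (ofPath δ.2 : PathAlgebra k Q) ∈ homPart k j a δ.1 :=
          Submodule.subset_span ⟨δ.2, mem_pathsFrom.1 hδ, rfl⟩
        have hρδ := vertex_mul_of_mem_homPart (hρ δ)
        have hρ' : ρ δ ∈ relPart R 2 δ.1 z := ⟨hρR δ, hρ δ⟩
        generalize ρ δ = σ at hρδ hρ' ⊢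
        rw [← hρδ]
        exact Submodule.subset_span ⟨δ.1, z, _, hz, σ, hρ', _, hδ', rfl⟩
      · obtain ⟨m, rfl⟩ : ∃ l, m = l + 1 := ⟨m - 1, by omega⟩
        refine sum_mem fun β _ => ?_
        have h1 := (g β).2.2
        simp only [SetLike.mem_coe, Submodule.mem_iInf] at h1
        rw [show m + 1 - j = (m - j) + 1 by omega]
        exact mul_mem_sandwich (arrow_mem_homPart β.2) (h1 j (by omega))
    refine ⟨⟨sandwich_mem R (key 0 (Nat.zero_le _)), hhom⟩, ?_⟩
    simp only [SetLike.mem_coe, Submodule.mem_iInf]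
    exact key

/-- Writing t as the sum of the β̄ ⊗ g_β, the preimage is the sum over z of e_z ⊗ ∑ β g_β. The cycle
condition is phrased so as to be vacuous for n = 0, where the next map is the augmentation and kills
all of degree one. -/
theorem exists_preimage_of_degree_one (hR : IsQuadratic R) {t : koszulTerm R a n}
    (ht : koszulEquiv R a n t ∈ projSumDegree R (koszulVertex R a n) 1)
    (hd : ∀ m, ∀ h : n = m + 1, koszulD R a m (h ▸ t) = 0) :
    ∃ s : koszulTerm R a (n + 1),
      koszulEquiv R a (n + 1) s ∈ projSumDegree R (koszulVertex R a (n + 1)) 0 ∧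
        koszulD R a n s = t := by
  choose g hg using fun (z : Q) (β : Quiver.Costar z) => exists_arrow_part hR t β.2
  obtain ⟨s, hs, hs'⟩ := exists_koszul_degree_zero fun z =>
    (⟨_, sum_arrow_mul_mem_koszulPart hR ht hd z (g z) (hg z)⟩ : koszulPart R (n + 1) a z)
  refine ⟨s, hs, koszulCoeff_ext fun y δ _ => Subtype.ext ?_⟩
  rw [coe_koszulCoeff_koszulD]
  conv_rhs => rw [eq_sum_arrowCoeff hR (koszulCoeff_mem ht δ)]
  refine Finset.sum_congr rfl fun α _ => ?_
  rw [hs', smul_mul_assoc, idem_mul_arrow, ← pathCoeff_strip,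
    strip_sum_arrow_mul α.2 fun β => koszulPart_le R n a β.1 (g α.1 β).2, hg]

/-! ### The Koszul differential squares to zero -/

/-- The linear map `kQ → Λ` taking the class of the part of `γ` that ends (on the right) with a
given path `δ`, preceded by two arrows. -/
def twoArrowPart (R : TwoSidedIdeal (PathAlgebra k Q)) {y : Q} (δ : Quiver.Path a y) :
    PathAlgebra k Q →ₗ[k] AlgOne R :=
  ∑ β : Quiver.Star y, ∑ α : Quiver.Star β.1,
    (pathCoeff ⟨a, α.1, (δ.cons β.2).cons α.2⟩).smulRight (arrow R α.2 * arrow R β.2)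

theorem twoArrowPart_apply {y : Q} (δ : Quiver.Path a y) (f : PathAlgebra k Q) :
    twoArrowPart R δ f = ∑ β : Quiver.Star y, ∑ α : Quiver.Star β.1,
      pathCoeff ⟨a, α.1, (δ.cons β.2).cons α.2⟩ f • (arrow R α.2 * arrow R β.2) := by
  simp [twoArrowPart]

-- On ρ p with ρ a quadratic relation and p a path, the value is the class of ρ if p = δ and 0
-- otherwise. Both vanish.
open Classical in
theorem twoArrowPart_eq_zero {y z : Q} (δ : Quiver.Path a y) {f : PathAlgebra k Q}
    (hf : f ∈ sandwich R 0 n a z) : twoArrowPart R δ f = 0 := by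
  have hpath : ∀ (c d : Q) (p : Quiver.Path a c) (q : Quiver.Path c d), q.length = 2 →
      twoArrowPart R δ (ofPath q * ofPath p) =
        if (⟨c, p⟩ : Σ y : Q, Quiver.Path a y) = ⟨y, δ⟩ then bar R (ofPath q) else 0 := by
    intro c d p q hq
    cases q with
    | nil => simp at hq
    | @cons c' _ q α₀ =>
    cases q with
    | nil => simp at hq
    | @cons c'' _ q β₀ =>
    cases q with
    | cons q _ => simp at hq
    | nil =>
    rw [twoArrowPart_apply, ofPath_mul_ofPath]
    simp only [Quiver.Path.comp_cons, Quiver.Path.comp_nil]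
    split_ifs with h
    · cases h
      rw [Finset.sum_eq_single (⟨c', β₀⟩ : Quiver.Star y),
        Finset.sum_eq_single (⟨d, α₀⟩ : Quiver.Star c')]
      · rw [pathCoeff_ofPath_self, one_smul, arrow, arrow, ← bar_mul, ofPath_mul_ofPath]
        rfl
      · rintro ⟨d', α⟩ - h
        rw [pathCoeff_ofPath_of_ne, zero_smul]
        intro h'
        cases h'
        exact h rfl
      · intro h
        exact absurd (Finset.mem_univ _) h
      · rintro ⟨d', β⟩ - h
        refine Finset.sum_eq_zero fun α _ => ?_
        rw [pathCoeff_ofPath_of_ne, zero_smul]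
        intro h'
        cases h'
        exact h rfl
      · intro h
        exact absurd (Finset.mem_univ _) h
    · refine Finset.sum_eq_zero fun β _ => Finset.sum_eq_zero fun α _ => ?_
      rw [pathCoeff_ofPath_of_ne, zero_smul]
      intro h'
      cases h'
      exact h rfl
  have hmul : ∀ (c d : Q) (p : Quiver.Path a c) (ρ : PathAlgebra k Q), ρ ∈ homPart k 2 c d →
      ρ ∈ R → twoArrowPart R δ (ρ * ofPath p) = 0 := by
    intro c d p ρ hρ hρR
    have h1 : twoArrowPart R δ (ρ * ofPath p) =
        if (⟨c, p⟩ : Σ y : Q, Quiver.Path a y) = ⟨y, δ⟩ then bar R ρ else 0 := by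
      clear hρR
      induction hρ using Submodule.span_induction with
      | zero => simp
      | add f g _ _ hf hg => rw [add_mul, map_add, map_add, hf, hg]; split_ifs <;> simp
      | smul c f _ hf => rw [smul_mul_assoc, map_smul, map_smul, hf]; split_ifs <;> simp
      | mem f hf =>
        obtain ⟨q, hq, rfl⟩ := hf
        exact hpath _ _ p q hq
    rw [h1, (bar_eq_zero R).2 hρR, ite_self]
  induction hf using Submodule.span_induction with
  | zero => simp
  | add f g _ _ hf hg => rw [map_add, hf, hg, add_zero]
  | smul c f _ hf => rw [map_smul, hf, smul_zero]
  | mem f hf =>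
    obtain ⟨b, c, ζ, hζ, ρ, hρ, ξ, hξ, rfl⟩ := hf
    have h1 : ζ * ρ ∈ homPart k 2 b z := mul_mem_homPart (m := 0) (n := 2) hζ hρ.2
    have h2 : ζ * ρ ∈ R := R.mul_mem_left _ _ hρ.1
    induction hξ using Submodule.span_induction with
    | zero => simp
    | add f g _ _ hf hg => rw [mul_add, map_add, hf, hg, add_zero]
    | smul c f _ hf => rw [mul_smul_comm, map_smul, hf, smul_zero]
    | mem f hf =>
      obtain ⟨p, -, rfl⟩ := hf
      exact hmul b z p _ h1 h2

/-- The coefficient at δ of the twofold differential of u ⊗ γ is u times `twoArrowPart` of γ. Only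
the condition j = n in the definition of R^{(n+2)} is used. -/
theorem koszulD_koszulD (t : koszulTerm R a (n + 2)) :
    koszulD R a n (koszulD R a (n + 1) t) = 0 := by
  have h : (koszulD R a n).comp (koszulD R a (n + 1)) = 0 := by
    refine koszul_ext fun z u r => koszulCoeff_ext fun y δ _ => Subtype.ext ?_
    rw [LinearMap.comp_apply, coe_koszulCoeff_koszulD]
    simp only [coe_koszulCoeff_koszulD, coe_koszulCoeff_incl]
    have h1 : (r : PathAlgebra k Q) ∈ sandwich R 0 n a z := by
      have h2 := r.2.2
      simp only [SetLike.mem_coe, Submodule.mem_iInf] at h2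
      have h3 := h2 n le_rfl
      rwa [Nat.sub_self] at h3
    have h2 := congrArg (fun v => (u : AlgOne R) * v) (twoArrowPart_eq_zero δ h1)
    simp only [twoArrowPart_apply, Finset.mul_sum, mul_zero, mul_smul_comm] at h2
    refine Eq.trans ?_ (h2.trans (congrArg Subtype.val (map_zero (koszulCoeff δ))).symm)
    simp only [Finset.sum_mul, smul_mul_assoc, mul_assoc]
  exact LinearMap.congr_fun h t

/-! ### The Koszul differential in degree zero -/

theorem koszulD_incl_mem {x : Q} {u : proj R x} (hu : (u : AlgOne R) ∈ gradedPart R 0)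
    (r : koszulPart R (n + 1) a x) :
    koszulEquiv R a n (koszulD R a n (koszulIncl R a (n + 1) x (u ⊗ₜ r))) ∈
      projSumDegree R (koszulVertex R a n) 1 := by
  rw [koszulD_incl, map_sum]
  refine sum_mem_projSumDegree _ fun α _ => koszulEquiv_incl_mem ?_ _
  exact mul_mem_gradedPart R (m := 0) (n := 1) hu (arrow_mem_gradedPart R α.2)

theorem koszulD_mem_degree_one {s : koszulTerm R a (n + 1)}
    (hs : koszulEquiv R a (n + 1) s ∈ projSumDegree R (koszulVertex R a (n + 1)) 0) :
    koszulEquiv R a n (koszulD R a n s) ∈ projSumDegree R (koszulVertex R a n) 1 := by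
  rw [← (koszulEquiv R a (n + 1)).symm_apply_apply s, koszulEquiv_symm_apply, map_sum, map_sum]
  exact sum_mem_projSumDegree _ fun i _ => koszulD_incl_mem (hs i) _

/-- In degree zero the coefficient at a path p is a multiple c_p of an idempotent. The coefficient
of the differential at δ is then the sum of the c_{αδ} ᾱ, and linear independence of arrows in Λ
forces every c_{αδ} to vanish. Since n + 1 > 0, every relevant path has the form αδ. -/
theorem eq_zero_of_koszulD_eq_zero (hR : IsQuadratic R) {s : koszulTerm R a (n + 1)}
    (hs : koszulEquiv R a (n + 1) s ∈ projSumDegree R (koszulVertex R a (n + 1)) 0)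
    (h : koszulD R a n s = 0) : s = 0 := by
  refine koszulCoeff_ext fun x p hp => Subtype.ext ?_
  rw [map_zero]
  cases p with
  | nil => simp at hp
  | @cons y _ δ α =>
  have key : ∀ (x : Q) (p : Quiver.Path a x), ∃ c : k, (koszulCoeff p s : AlgOne R) =
      c • idem R x := by
    intro x p
    obtain ⟨f, hf, hfu⟩ := koszulCoeff_mem hs p
    have h1 : (koszulCoeff p s : AlgOne R) =
        bar R (f * ofPath (Quiver.Path.nil : Quiver.Path x x)) := by
      rw [bar_mul, hfu]
      exact (mul_idem_of_mem_proj R (koszulCoeff p s).2).symm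
    rw [h1]
    clear h1 hfu
    induction hf using Submodule.span_induction with
    | zero => exact ⟨0, by simp⟩
    | add f g _ _ hf hg =>
      obtain ⟨c, hc⟩ := hf
      obtain ⟨d, hd⟩ := hg
      exact ⟨c + d, by rw [add_mul, map_add, hc, hd, add_smul]⟩
    | smul d f _ hf =>
      obtain ⟨c, hc⟩ := hf
      exact ⟨d * c, by rw [smul_mul_assoc, map_smul, hc, mul_smul]⟩
    | mem f hf =>
      obtain ⟨y, z, q, hq, rfl⟩ := hf
      cases q with
      | cons q α => simp at hq
      | nil =>
        by_cases hy : x = y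
        · subst hy
          exact ⟨1, by rw [ofPath_mul_ofPath, one_smul]; rfl⟩
        · exact ⟨0, by rw [ofPath_mul_ofPath_of_ne _ _ hy, map_zero, zero_smul]⟩
  choose c hc using key
  have h1 := coe_koszulCoeff_koszulD δ s
  rw [h, map_zero] at h1
  have h2 := congrArg (arrowCoeff hR α) h1
  rw [map_sum, Finset.sum_eq_single (⟨x, α⟩ : Quiver.Star y)] at h2
  · rw [hc, smul_mul_assoc, idem_mul_arrow, map_smul, arrow, arrowCoeff_bar,
      pathCoeff_ofPath_self, smul_eq_mul, mul_one] at h2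
    rw [hc, ← h2]
    simp
  · rintro ⟨x', β⟩ - hβ
    rw [hc, smul_mul_assoc, idem_mul_arrow, map_smul, arrow, arrowCoeff_bar,
      pathCoeff_ofPath_of_ne, smul_zero]
    intro h'
    cases h'
    exact hβ rfl
  · intro h
    exact absurd (Finset.mem_univ _) h

theorem koszulAug_eq_zero_of_degree_one {t : koszulTerm R a 0}
    (ht : koszulEquiv R a 0 t ∈ projSumDegree R (koszulVertex R a 0) 1) :
    koszulAug R a t = 0 := by
  rw [koszulAug_apply]
  exact (Submodule.Quotient.mk_eq_zero _).2
    (mem_radMul_proj R (gradedPart_le_gePart R 1 (koszulCoeff_mem ht _)))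

theorem eq_zero_of_koszulAug_eq_zero (hR : IsQuadratic R) {t : koszulTerm R a 0}
    (ht : koszulEquiv R a 0 t ∈ projSumDegree R (koszulVertex R a 0) 0)
    (h : koszulAug R a t = 0) : t = 0 := by
  refine koszulCoeff_ext fun x p hp => Subtype.ext ?_
  rw [map_zero]
  cases p with
  | cons p α => simp at hp
  | nil =>
    rw [koszulAug_apply] at h
    exact eq_zero_of_mem_gradedPart_of_mem_gePart R hR zero_le_one (koszulCoeff_mem ht _)
      (mem_gePart_of_mem_radMul_proj R ((Submodule.Quotient.mk_eq_zero _).1 h))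

/-! ### Transport to finite direct sums and conclusion -/

/-- The differential of the local Koszul complex, written on finite direct sums of the `Pₓ`. -/
def koszulSumD (R : TwoSidedIdeal (PathAlgebra k Q)) (a : Q) (n : ℕ) :
    projSum R (koszulVertex R a (n + 1)) →ₗ[AlgOne R] projSum R (koszulVertex R a n) :=
  (koszulEquiv R a n).toLinearMap.comp
    ((koszulD R a n).comp (koszulEquiv R a (n + 1)).symm.toLinearMap)

/-- The augmentation of the local Koszul complex, written on finite direct sums of the `Pₓ`. -/
def koszulSumAug (R : TwoSidedIdeal (PathAlgebra k Q)) (a : Q) :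
    projSum R (koszulVertex R a 0) →ₗ[AlgOne R] simple R a :=
  (koszulAug R a).comp (koszulEquiv R a 0).symm.toLinearMap

theorem koszulSumD_equiv (t : koszulTerm R a (n + 1)) :
    koszulSumD R a n (koszulEquiv R a (n + 1) t) = koszulEquiv R a n (koszulD R a n t) := by
  simp [koszulSumD]

theorem koszulSumAug_equiv (t : koszulTerm R a 0) :
    koszulSumAug R a (koszulEquiv R a 0 t) = koszulAug R a t := by
  simp [koszulSumAug]

/-- The local Koszul complex is diagonal. -/
theorem isDiagonal_koszul (hR : IsQuadratic R) (a : Q) :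
    IsDiagonal (koszulSumD R a) (koszulSumAug R a) where
  aug_surjective := koszulAug_surjective.comp (koszulEquiv R a 0).symm.surjective
  injOn_aug := by
    refine injOn_of_eq_zero _ fun v hv h => ?_
    obtain ⟨t, rfl⟩ := (koszulEquiv R a 0).surjective v
    rw [koszulSumAug_equiv] at h
    rw [eq_zero_of_koszulAug_eq_zero hR hv h, map_zero]
  injOn n := by
    refine injOn_of_eq_zero _ fun v hv h => ?_
    obtain ⟨t, rfl⟩ := (koszulEquiv R a (n + 1)).surjective v
    rw [koszulSumD_equiv] at h
    rw [eq_zero_of_koszulD_eq_zero hR hv ((koszulEquiv R a n).map_eq_zero_iff.1 h), map_zero]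
  image_zero := by
    ext v
    obtain ⟨t, rfl⟩ := (koszulEquiv R a 0).surjective v
    constructor
    · rintro ⟨w, hw, h⟩
      obtain ⟨s, rfl⟩ := (koszulEquiv R a 1).surjective w
      rw [koszulSumD_equiv] at h
      have h1 := koszulD_mem_degree_one hw
      rw [h] at h1
      exact ⟨h1, (koszulSumAug_equiv t).trans (koszulAug_eq_zero_of_degree_one h1)⟩
    · rintro ⟨h1, -⟩
      obtain ⟨s, hs, rfl⟩ := exists_preimage_of_degree_one hR h1 fun m h => absurd h (by omega)
      exact ⟨_, hs, koszulSumD_equiv s⟩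
  image_succ n := by
    ext v
    obtain ⟨t, rfl⟩ := (koszulEquiv R a (n + 1)).surjective v
    constructor
    · rintro ⟨w, hw, h⟩
      obtain ⟨s, rfl⟩ := (koszulEquiv R a (n + 2)).surjective w
      rw [koszulSumD_equiv] at h
      have h1 := koszulD_mem_degree_one hw
      rw [h] at h1
      refine ⟨h1, (koszulSumD_equiv t).trans ?_⟩
      rw [← (koszulEquiv R a (n + 1)).injective h, koszulD_koszulD, map_zero]
    · rintro ⟨h1, h2⟩
      have h3 : koszulD R a n t = 0 :=
        (koszulEquiv R a n).map_eq_zero_iff.1 ((koszulSumD_equiv t).symm.trans h2)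
      obtain ⟨s, hs, rfl⟩ := exists_preimage_of_degree_one hR h1 fun m h => by
        obtain rfl : n = m := by omega
        exact h3
      exact ⟨_, hs, koszulSumD_equiv s⟩

theorem exact_koszulSumD_iff : Function.Exact (koszulSumD R a (n + 1)) (koszulSumD R a n) ↔
    Function.Exact (koszulD R a (n + 1)) (koszulD R a n) := by
  constructor
  · intro h t
    rw [← (koszulEquiv R a n).map_eq_zero_iff, ← koszulSumD_equiv, h]
    constructor
    · rintro ⟨w, hw⟩
      obtain ⟨s, rfl⟩ := (koszulEquiv R a (n + 2)).surjective w
      rw [koszulSumD_equiv] at hw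
      exact ⟨s, (koszulEquiv R a (n + 1)).injective hw⟩
    · rintro ⟨s, rfl⟩
      exact ⟨_, koszulSumD_equiv s⟩
  · intro h v
    obtain ⟨t, rfl⟩ := (koszulEquiv R a (n + 1)).surjective v
    rw [koszulSumD_equiv, (koszulEquiv R a n).map_eq_zero_iff, h]
    constructor
    · rintro ⟨s, rfl⟩
      exact ⟨_, koszulSumD_equiv s⟩
    · rintro ⟨w, hw⟩
      obtain ⟨s, rfl⟩ := (koszulEquiv R a (n + 2)).surjective w
      rw [koszulSumD_equiv] at hw
      exact ⟨s, (koszulEquiv R a (n + 1)).injective hw⟩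

theorem exact_koszulAug (hR : IsQuadratic R) (a : Q) :
    Function.Exact (koszulD R a 0) (koszulAug R a) := by
  intro t
  rw [← koszulSumAug_equiv, (isDiagonal_koszul hR a).exact_zero (radMul_simple R a)]
  constructor
  · rintro ⟨w, hw⟩
    obtain ⟨s, rfl⟩ := (koszulEquiv R a 1).surjective w
    rw [koszulSumD_equiv] at hw
    exact ⟨s, (koszulEquiv R a 0).injective hw⟩
  · rintro ⟨s, rfl⟩
    exact ⟨_, koszulSumD_equiv s⟩

theorem isProjectiveResolution_koszul_iff (hR : IsQuadratic R) (a : Q) :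
    IsProjectiveResolution R (simple R a) (koszulTerm R a) (koszulD R a) (koszulAug R a) ↔
      ∀ n : ℕ, Function.Exact (koszulD R a (n + 1)) (koszulD R a n) :=
  ⟨fun h => h.exact_succ, fun h =>
    { projective := fun _ => inferInstance
      aug_surjective := koszulAug_surjective
      exact_zero := exact_koszulAug hR a
      exact_succ := h }⟩

/-- Both directions rest on diagonality of the Koszul complex: comparison with a given resolution
yields exactness, and exactness makes the Koszul complex itself a linear resolution. -/
theorem nonempty_linearProjectiveResolution_iff (hR : IsQuadratic R) (a : Q) :
    Nonempty (LinearProjectiveResolution R (simple R a)) ↔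
      ∀ n : ℕ, Function.Exact (koszulD R a (n + 1)) (koszulD R a n) :=
  ⟨fun ⟨P⟩ n => exact_koszulSumD_iff.1
      ((isDiagonal_koszul hR a).exact_of_resolution hR (radMul_simple R a) P n),
    fun h => ⟨(isDiagonal_koszul hR a).toResolution (radMul_simple R a)
      fun n => exact_koszulSumD_iff.2 (h n)⟩⟩

end BoundQuiver

end

theorem theorem3p5 {k : Type*} [Field k] {Q : Type*} [Quiver Q] [Quiver.IsLocallyFinite Q]
    (R : TwoSidedIdeal (PathAlgebra k Q)) (hR : PathAlgebra.IsQuadratic R) (a : Q) :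
    (Nonempty (BoundQuiver.LinearProjectiveResolution R (BoundQuiver.simple R a)) ↔
      BoundQuiver.IsProjectiveResolution R (BoundQuiver.simple R a) (BoundQuiver.koszulTerm R a)
        (BoundQuiver.koszulD R a) (BoundQuiver.koszulAug R a)) ∧
    (BoundQuiver.IsProjectiveResolution R (BoundQuiver.simple R a) (BoundQuiver.koszulTerm R a)
        (BoundQuiver.koszulD R a) (BoundQuiver.koszulAug R a) ↔
      ∀ n : ℕ, Function.Exact (BoundQuiver.koszulD R a (n + 1)) (BoundQuiver.koszulD R a n)) :=
  ⟨(BoundQuiver.nonempty_linearProjectiveResolution_iff hR a).trans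
      (BoundQuiver.isProjectiveResolution_koszul_iff hR a).symm,
    BoundQuiver.isProjectiveResolution_koszul_iff hR a⟩
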